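/- **Setting.** A family of binary observables $(A_w)_{w\in W}$ ($W$ finite) on $\mathbb C^d$, $d\ge 1$, consists of Hermitian matrices with $A_w^2=I$; it has anti-commutativity graph $H$ (a simple graph on $W$) if $A_wA_{w'}=-A_{w'}A_w$ exactly when $w,w'$ are adjacent in $H$, and $A_wA_{w'}=A_{w'}A_w$ whenever they are not adjacent. For $t\in[0,1]$ put $A_w^t=tA_w+\frac{\operatorname{tr}A_w}{d}(1-t)I$; the family $(A_w^t)_w$ is jointly measurable if there are positive semidefinite matrices $E(a)$, $a\in\{\pm1\}^W$, with $\sum_a E(a)=I$ and $\sum_{a:\,a_w=s}E(a)=\frac12(I+sA_w^t)$ for all $w\in W$, $s=\pm1$. The incompatibility robustness $\eta(H)$ is the largest $t\in[0,1]$ for which $(A_w^t)_w$ is jointly measurable, where $(A_w)$ is a family with anti-commutativity graph $H$. For an orientation $\sigma$ of a finite simple graph $G=(V,E)$, the skew-adjacency matrix $S(G^\sigma)\in\mathbb R^{V\times V}$ has entries $S_{uv}=1$ if $u\to v$, $S_{uv}=-1$ if $v\to u$, and $S_{uv}=0$ otherwise. The skew-energy $\mathcal E_s(G^\sigma)$ is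 the sum of the absolute values of the complex eigenvalues of $S(G^\sigma)$, counted with multiplicity, and $\mathcal E_s^{\max}(G)=\max_\sigma\mathcal E_s(G^\sigma)$ over all orientations. $G$ is edge-transitive if for all $e,e'\in E$ some automorphism of $G$ maps $e$ to $e'$. The line graph $L(G)$ has vertex set $E$, two distinct edges being adjacent when they share an endpoint. **Theorem.** Let $G=(V,E)$ be a finite simple graph with $E\neq\emptyset$. 1. There are, for some $d\ge1$, Hermitian matrices $\Gamma_v\in\mathbb C^{d\times d}$ ($v\in V$) with $\Gamma_u\Gamma_v+\Gamma_v\Gamma_u=2\delta_{uv}I$ (Majorana operators), and for any such matrices, with any $d\ge1$, the quadratic observables $A_{\{u,v\}}=i\Gamma_u\Gamma_v$, $\{u,v\}\in E$ (with any choice of the order of the two endpoints), have anti-commutativity graph $L(G)$. 2. $\eta(L(G))$ is well defined: the maximum exists and is the same for every family of binary observables, in any dimension $d\ge1$, with anti-commutativity graph $L(G)$. 3. $$\eta(L(G))\;\le\;\frac{\mathcal E_s^{\max}(G)}{2|E|}.$$ 4. If $G$ is edge-transitive, then $\eta(L(G))=\mathcal E_s^{\max}(G)/(2|E|)$. -/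

import Mathlib

open scoped ComplexOrder

/-! ### Binary observables, joint measurability and incompatibility robustness -/

section Measurements

variable {W : Type*} {d : ℕ}

/-- A family of observables `A v` on `ℂ^d` (Hermitian, with `(A v)² = 1`) whose anti-commutativity
graph is `H`: adjacent vertices are exactly the anti-commuting pairs, and the observables at
non-adjacent vertices commute. -/
structure HasAntiCommGraph (H : SimpleGraph W) (A : W → Matrix (Fin d) (Fin d) ℂ) : Prop where
  isHermitian : ∀ v, (A v).IsHermitian
  mul_self : ∀ v, A v * A v = 1
  adj_iff : ∀ v w, H.Adj v w ↔ A v * A w = -(A w * A v)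
  commute : ∀ v w, ¬ H.Adj v w → A v * A w = A w * A v

/-- A positive operator-valued measure on `ℂ^d` with finite outcome set `Ω`. -/
structure IsPOVM {Ω : Type*} [Fintype Ω] (E : Ω → Matrix (Fin d) (Fin d) ℂ) : Prop where
  posSemidef : ∀ a, (E a).PosSemidef
  sum_eq_one : ∑ a, E a = 1

/-- The two-outcome measurements `M v (±1)`, `v ∈ W`, are jointly measurable: they are the
marginals of one parent POVM with outcomes in `{±1}^W`. -/
def JointlyMeasurable [Fintype W] [DecidableEq W]
    (M : W → ℤˣ → Matrix (Fin d) (Fin d) ℂ) : Prop :=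
  ∃ E : (W → ℤˣ) → Matrix (Fin d) (Fin d) ℂ, IsPOVM E ∧
    ∀ (v : W) (s : ℤˣ), M v s = ∑ a : W → ℤˣ with a v = s, E a

/-- The effects `(1 ± B) / 2` of a (possibly unsharp) binary observable `B`. -/
noncomputable def binaryEffect (B : Matrix (Fin d) (Fin d) ℂ) (s : ℤˣ) :
    Matrix (Fin d) (Fin d) ℂ :=
  (1 / 2 : ℂ) • (1 + ((s : ℤ) : ℂ) • B)

/-- The noisy observable `t A + (tr A / d) (1 - t) 1`. -/
noncomputable def noisyObservable (t : ℝ) (A : Matrix (Fin d) (Fin d) ℂ) :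
    Matrix (Fin d) (Fin d) ℂ :=
  (t : ℂ) • A + (A.trace / (d : ℂ) * (1 - (t : ℂ))) • (1 : Matrix (Fin d) (Fin d) ℂ)

/-- The visibilities `t ∈ [0, 1]` at which the noisy versions of the observables `A v` are jointly
measurable. -/
def compatibleVisibilities [Fintype W] [DecidableEq W]
    (A : W → Matrix (Fin d) (Fin d) ℂ) : Set ℝ :=
  {t | t ∈ Set.Icc (0 : ℝ) 1 ∧
    JointlyMeasurable fun v s => binaryEffect (noisyObservable t (A v)) s}

/-- The incompatibility robustness `η(H)` of a graph: the largest visibility at which a family of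
binary observables with anti-commutativity graph `H` is jointly measurable. -/
noncomputable def incompatibilityRobustness [Fintype W] [DecidableEq W]
    (H : SimpleGraph W) : ℝ :=
  sSup {t | ∃ d : ℕ, 0 < d ∧ ∃ A : W → Matrix (Fin d) (Fin d) ℂ,
    HasAntiCommGraph H A ∧ t ∈ compatibleVisibilities A}

end Measurements

/-! ### Majorana operators -/

section Majorana

variable {V : Type*} {d : ℕ}

/-- Majorana operators on `ℂ^d` labelled by `V`. -/
structure IsMajoranaFamily (Γ : V → Matrix (Fin d) (Fin d) ℂ) : Prop where
  isHermitian : ∀ v, (Γ v).IsHermitian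
  mul_self : ∀ v, Γ v * Γ v = 1
  anticommute : ∀ u v, u ≠ v → Γ u * Γ v + Γ v * Γ u = 0

/-- The quadratic Majorana observables of the coupling graph `G`: the edge `{u, v}` carries
`i Γ_u Γ_v`, for one of the two orderings of its endpoints. -/
def IsQuadraticFamily (G : SimpleGraph V) (Γ : V → Matrix (Fin d) (Fin d) ℂ)
    (A : G.edgeSet → Matrix (Fin d) (Fin d) ℂ) : Prop :=
  ∀ e : G.edgeSet, ∃ u v : V, (e : Sym2 V) = s(u, v) ∧ A e = Complex.I • (Γ u * Γ v)

end Majorana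

/-! ### Orientations, skew-energy and edge-transitivity -/

section Graphs

variable {V : Type*}

/-- An orientation of `G`: a sign `σ(u, v) = -σ(v, u)` for every edge `{u, v}`, where
`σ(u, v) = 1` means `u → v`. -/
def GraphOrientation (G : SimpleGraph V) : Type _ :=
  {σ : G.Dart → ℤˣ // ∀ e : G.Dart, σ e.symm = -σ e}

/-- The skew-adjacency matrix of an oriented graph. -/
def skewAdjMatrix (G : SimpleGraph V) [DecidableRel G.Adj] (σ : GraphOrientation G) :
    Matrix V V ℝ :=
  Matrix.of fun u v => if h : G.Adj u v then ((σ.1 ⟨(u, v), h⟩ : ℤ) : ℝ) else 0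

/-- The skew-energy: the sum of the absolute values of the complex eigenvalues, with multiplicity,
of the skew-adjacency matrix. -/
noncomputable def skewEnergy [Fintype V] [DecidableEq V] (G : SimpleGraph V) [DecidableRel G.Adj]
    (σ : GraphOrientation G) : ℝ :=
  ((((skewAdjMatrix G σ).map (algebraMap ℝ ℂ)).charpoly.roots).map fun z : ℂ => ‖z‖).sum

/-- The maximum skew-energy of `G` over all (finitely many) orientations. -/
noncomputable def maxSkewEnergy [Fintype V] [DecidableEq V] (G : SimpleGraph V)
    [DecidableRel G.Adj] : ℝ :=
  ⨆ σ : GraphOrientation G, skewEnergy G σ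

/-- `G` is edge-transitive: its automorphism group acts transitively on the edges. -/
def IsEdgeTransitive (G : SimpleGraph V) : Prop :=
  ∀ e ∈ G.edgeSet, ∀ e' ∈ G.edgeSet, ∃ f : G ≃g G, Sym2.map f e = e'

end Graphs

/-! The theorem rests on one observation about two realisations `A`, `B` of the same
anti-commutativity graph: the products `A w ⊗ B w` commute, since the two signs cancel, so they have
a common spectral measure `P`. Measuring `P` with the second system in a state `ρ` is a measurement
on the first system alone, with outcome averages `tr (ρ B w) • A w`
(`exists_povm_of_hasAntiCommGraph`). It is used in two ways.

* With `B` equipped with a parent measurement and the second system maximally mixed, multiplying the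
  outcomes of `P` by those of the parent of `B` gives a parent for `A` with the same visibility.
  Hence all realisations have the same visibilities (`compatibleVisibilities_subset`), a nonempty
  compact set, and the robustness is its maximum. Only at isolated vertices can the observables have
  nonzero trace; these commute with everything and are measured sharply instead.
* With `B` a quadratic Majorana family of `G` and a state of large total correlation, it produces
  joint measurements of the lower bound.

The numbers come from the Hamiltonians `∑ a_e A_e`, where `a` is a sign pattern, that is, an
orientation of `G`. Such an operator is `(1 / 2) ∑ h u v Γ_u Γ_v` with `h = i S` Hermitian and
antisymmetric, `S` the skew-adjacency matrix. Diagonalising `h` turns it into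
`(1 / 2) ∑ λ_k c_k c_kᴴ` with `c_k c_kᴴ + c_kᴴ c_k = 2`. As `∑ λ_k = 0`, it is bounded by
`(1 / 2) ∑ |λ_k|`, half the skew-energy (`IsMajoranaFamily.posSemidef_sub_quadraticHamiltonian`), and
the Fock vacuum attains this bound (`IsMajoranaFamily.exists_top_eigenvector`). Pairing a parent
measurement at visibility `t` with the observables gives `t |E| ≤ maxSkewEnergy G / 2`. Conversely,
the vacuum of an optimal orientation has correlations `c_e` with sum `maxSkewEnergy G / 2`, and
averaging over the automorphisms of an edge-transitive graph makes them all equal. -/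

open scoped Matrix

/-! ### Joint measurability and classical post-processing -/

section PostProcessing

variable {W : Type*} [Fintype W] [DecidableEq W] {d : ℕ}

theorem sum_intUnits {M : Type*} [AddCommMonoid M] (f : ℤˣ → M) : ∑ s, f s = f 1 + f (-1) := by
  rw [UnitsInt.univ, Finset.sum_pair (by decide)]

theorem intUnits_mul_self_complex (s : ℤˣ) : ((s : ℤ) : ℂ) * ((s : ℤ) : ℂ) = 1 := by
  rcases Int.units_eq_one_or s with rfl | rfl <;> simp

/-- Product distributions have the expected marginals. -/
theorem sum_prod_filter_eq {f : W → ℤˣ → ℝ} (hf : ∀ w, ∑ s, f w s = 1) (v : W) (s : ℤˣ) :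
    ∑ a : W → ℤˣ with a v = s, ∏ w, f w (a w) = f v s := by
  have h1 : (Finset.univ.filter fun a : W → ℤˣ => a v = s)
      = Fintype.piFinset fun w => if w = v then {s} else Finset.univ := by
    ext a
    simp only [Finset.mem_filter, Finset.mem_univ, true_and, Fintype.mem_piFinset]
    constructor
    · intro h w
      by_cases hw : w = v
      · subst hw; simp [h]
      · rw [if_neg hw]; exact Finset.mem_univ _
    · intro h
      simpa using h v
  rw [h1, ← Finset.prod_univ_sum, Finset.prod_eq_single v]
  · simp
  · intro w _ hw
    rw [if_neg hw, hf]
  · simp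

/-- Outcomes `c` of a single measurement `K`, followed by tossing for every `w` an independent coin
with mean `g w c`, measure all the binary observables `∑ c, g w c • K c` jointly. -/
theorem jointlyMeasurable_of_postProcessing {Ω : Type*} [Fintype Ω]
    {K : Ω → Matrix (Fin d) (Fin d) ℂ} (hK : IsPOVM K) (g : W → Ω → ℝ)
    (hg : ∀ w c, |g w c| ≤ 1) {N : W → Matrix (Fin d) (Fin d) ℂ}
    (hN : ∀ w, N w = ∑ c, (g w c : ℂ) • K c) :
    JointlyMeasurable fun w s => binaryEffect (N w) s := by
  set f : Ω → W → ℤˣ → ℝ := fun c w s => (1 + ((s : ℤ) : ℝ) * g w c) / 2 with hf_def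
  have hf0 : ∀ c w s, 0 ≤ f c w s := by
    intro c w s
    have := abs_le.mp (hg w c)
    rcases Int.units_eq_one_or s with rfl | rfl <;> simp [hf_def] <;> linarith
  have hf1 : ∀ c w, ∑ s, f c w s = 1 := by
    intro c w
    rw [sum_intUnits]
    simp [hf_def]
    ring
  refine ⟨fun a => ∑ c, ((∏ w, f c w (a w) : ℝ) : ℂ) • K c, ⟨fun a => ?_, ?_⟩, fun v s => ?_⟩
  · refine Matrix.posSemidef_sum _ fun c _ => (hK.posSemidef c).smul ?_
    exact_mod_cast Finset.prod_nonneg fun w _ => hf0 c w (a w)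
  · rw [Finset.sum_comm, ← hK.sum_eq_one]
    refine Finset.sum_congr rfl fun c _ => ?_
    rw [← Finset.sum_smul, ← Complex.ofReal_sum, ← Fintype.piFinset_univ,
      ← Finset.prod_univ_sum, Finset.prod_congr rfl fun w _ => hf1 c w]
    simp
  · rw [Finset.sum_comm]
    have h2 : ∀ c, ∑ a : W → ℤˣ with a v = s, ((∏ w, f c w (a w) : ℝ) : ℂ) • K c
        = (f c v s : ℂ) • K c := by
      intro c
      rw [← Finset.sum_smul, ← Complex.ofReal_sum, sum_prod_filter_eq (hf1 c)]
    simp only [h2]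
    rw [binaryEffect, hN, ← hK.sum_eq_one, Finset.smul_sum, ← Finset.sum_add_distrib,
      Finset.smul_sum]
    refine Finset.sum_congr rfl fun c _ => ?_
    rw [smul_smul]
    conv_lhs => rw [← one_smul ℂ (K c), smul_smul, mul_one, ← add_smul, smul_smul]
    congr 1
    simp [hf_def]
    ring

/-- The observables are recovered from a parent measurement as averages of the outcomes. -/
theorem JointlyMeasurable.exists_parent {N : W → Matrix (Fin d) (Fin d) ℂ}
    (h : JointlyMeasurable fun w s => binaryEffect (N w) s) :
    ∃ E : (W → ℤˣ) → Matrix (Fin d) (Fin d) ℂ, IsPOVM E ∧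
      ∀ w, N w = ∑ a, ((a w : ℤ) : ℂ) • E a := by
  obtain ⟨E, hE, hm⟩ := h
  refine ⟨E, hE, fun w => ?_⟩
  rw [← Finset.sum_fiberwise Finset.univ (fun a : W → ℤˣ => a w)]
  have h1 : ∀ s : ℤˣ, ∑ a : W → ℤˣ with a w = s, ((a w : ℤ) : ℂ) • E a
      = ((s : ℤ) : ℂ) • binaryEffect (N w) s := by
    intro s
    have := hm w s
    simp only at this
    rw [this, Finset.smul_sum]
    refine Finset.sum_congr rfl fun a ha => ?_
    rw [(Finset.mem_filter.mp ha).2]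
  simp only [h1]
  rw [sum_intUnits]
  simp only [binaryEffect, smul_add, smul_smul]
  norm_num
  module

end PostProcessing

/-! ### Commuting involutions are jointly measurable -/

section Commuting

variable {W : Type*} [Fintype W] [DecidableEq W]

/-- In a commutative star algebra, the products of the spectral projections `(1 ± c w) / 2` of
self-adjoint involutions `c w` form a common resolution of the identity. -/
theorem exists_resolution_of_involutions {R : Type*} [CommRing R] [StarRing R] [Algebra ℂ R]
    [StarModule ℂ R] {c : W → R} (hcs : ∀ w, star (c w) = c w) (hcc : ∀ w, c w * c w = 1) :
    ∃ p : (W → ℤˣ) → R, (∀ s, star (p s) = p s) ∧ (∀ s, p s * p s = p s) ∧ ∑ s, p s = 1 ∧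
      ∀ w, ∑ s, ((s w : ℤ) : ℂ) • p s = c w := by
  let q : W → ℤˣ → R := fun w s => (1 / 2 : ℂ) • (1 + ((s : ℤ) : ℂ) • c w)
  have hq1 : ∀ w, ∑ s, q w s = 1 := by
    intro w
    rw [sum_intUnits]
    simp only [q]
    push_cast
    module
  have hqs : ∀ w s, star (q w s) = q w s := by
    intro w s
    simp [q, star_smul, hcs]
  have hqc : ∀ w s, c w * q w s = ((s : ℤ) : ℂ) • q w s := by
    intro w s
    simp only [q, mul_smul_comm, mul_add, mul_one, hcc]
    rcases Int.units_eq_one_or s with rfl | rfl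
    · push_cast; module
    · push_cast; module
  have hqq : ∀ w s, q w s * q w s = q w s := by
    intro w s
    have h : q w s * q w s = (1 / 2 : ℂ) • (q w s + ((s : ℤ) : ℂ) • (c w * q w s)) := by
      conv_lhs => enter [1]; simp only [q]
      rw [smul_mul_assoc, add_mul, smul_mul_assoc, one_mul]
    rw [h, hqc, smul_smul, intUnits_mul_self_complex]
    module
  have hpc : ∀ w (s : W → ℤˣ), c w * ∏ v, q v (s v) = ((s w : ℤ) : ℂ) • ∏ v, q v (s v) := by
    intro w s
    rw [← Finset.mul_prod_erase _ _ (Finset.mem_univ w), ← mul_assoc, hqc, smul_mul_assoc]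
  have hp1 : ∑ s : W → ℤˣ, ∏ v, q v (s v) = 1 := by
    rw [← Fintype.piFinset_univ, ← Finset.prod_univ_sum, Finset.prod_congr rfl fun w _ => hq1 w]
    simp
  refine ⟨fun s => ∏ v, q v (s v), fun s => ?_, fun s => ?_, hp1, fun w => ?_⟩
  · simp only [star_prod, hqs]
  · simp only [← Finset.prod_mul_distrib, hqq]
  · simp only [← hpc]
    rw [← Finset.mul_sum, hp1, mul_one]

variable {n : Type*} [Fintype n] [DecidableEq n]

open scoped IsMulCommutative in
/-- Commuting Hermitian involutions `C w` have a common spectral measure. -/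
theorem exists_spectral_measure_of_commute {C : W → Matrix n n ℂ} (hC : ∀ w, (C w).IsHermitian)
    (hsq : ∀ w, C w * C w = 1) (hcomm : ∀ v w, C v * C w = C w * C v) :
    ∃ P : (W → ℤˣ) → Matrix n n ℂ, (∀ s, (P s).PosSemidef) ∧ ∑ s, P s = 1 ∧
      ∀ w, ∑ s, ((s w : ℤ) : ℂ) • P s = C w := by
  have hstar : ∀ w, star (C w) = C w := fun w => hC w
  -- finite products make sense in the commutative star subalgebra generated by the `C w`
  have hS : IsMulCommutative (StarAlgebra.adjoin ℂ (Set.range C)) :=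
    StarAlgebra.isMulCommutative_adjoin ℂ
      (by rintro _ ⟨v, rfl⟩ _ ⟨w, rfl⟩; exact hcomm v w)
      (by rintro _ ⟨v, rfl⟩ _ ⟨w, rfl⟩; rw [hstar]; exact hcomm v w)
  obtain ⟨p, hps, hpp, hp1, hpc⟩ := exists_resolution_of_involutions (W := W)
    (R := StarAlgebra.adjoin ℂ (Set.range C))
    (c := fun w => ⟨C w, StarAlgebra.subset_adjoin ℂ _ ⟨w, rfl⟩⟩)
    (fun w => Subtype.ext (hstar w)) (fun w => Subtype.ext (hsq w))
  refine ⟨fun s => (p s : Matrix n n ℂ), fun s => ?_, ?_, fun w => ?_⟩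
  · have h1 : (p s : Matrix n n ℂ)ᴴ = p s := congrArg Subtype.val (hps s)
    have h2 : (p s : Matrix n n ℂ) * p s = p s := congrArg Subtype.val (hpp s)
    have := Matrix.posSemidef_conjTranspose_mul_self (p s : Matrix n n ℂ)
    rwa [h1, h2] at this
  · simpa using congrArg Subtype.val hp1
  · simpa using congrArg Subtype.val (hpc w)

end Commuting

/-! ### Traces and partial traces of positive semidefinite matrices -/

open scoped MatrixOrder in
theorem Matrix.PosSemidef.exists_eq_conjTranspose_mul_self {n : Type*} [Fintype n]
    {P : Matrix n n ℂ} (hP : P.PosSemidef) : ∃ R : Matrix n n ℂ, P = Rᴴ * R := by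
  classical
  exact CStarAlgebra.nonneg_iff_eq_star_mul_self.mp hP.nonneg

theorem Matrix.PosSemidef.trace_mul_nonneg {n : Type*} [Fintype n] {P Q : Matrix n n ℂ}
    (hP : P.PosSemidef) (hQ : Q.PosSemidef) : 0 ≤ (P * Q).trace := by
  obtain ⟨R, rfl⟩ := hP.exists_eq_conjTranspose_mul_self
  rw [mul_assoc, Matrix.trace_mul_comm]
  exact (hQ.mul_mul_conjTranspose_same R).trace_nonneg

section PartialTrace

open scoped Kronecker

variable {m n : Type*} [Fintype n]

/-- The partial trace over the second tensor factor. -/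
def partialTrace : Matrix (m × n) (m × n) ℂ →ₗ[ℂ] Matrix m m ℂ where
  toFun X := Matrix.of fun i j => ∑ k, X (i, k) (j, k)
  map_add' X Y := by ext; simp [Finset.sum_add_distrib]
  map_smul' c X := by ext; simp [Finset.mul_sum]

theorem partialTrace_apply (X : Matrix (m × n) (m × n) ℂ) (i j : m) :
    partialTrace X i j = ∑ k, X (i, k) (j, k) := rfl

theorem partialTrace_kronecker (A : Matrix m m ℂ) (B : Matrix n n ℂ) :
    partialTrace (A ⊗ₖ B) = B.trace • A := by
  ext i j
  simp [partialTrace_apply, Matrix.trace, ← Finset.mul_sum, mul_comm]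

theorem posSemidef_partialTrace {X : Matrix (m × n) (m × n) ℂ} (hX : X.PosSemidef) :
    (partialTrace X).PosSemidef := by
  have : partialTrace X = ∑ k, X.submatrix (fun i => (i, k)) (fun i => (i, k)) := by
    ext i j
    simp [partialTrace_apply, Matrix.sum_apply]
  rw [this]
  exact Matrix.posSemidef_sum _ fun k _ => hX.submatrix _

variable [Fintype m] [DecidableEq m]

theorem partialTrace_mul_one_kronecker (X : Matrix (m × n) (m × n) ℂ) (B : Matrix n n ℂ) :
    partialTrace (X * ((1 : Matrix m m ℂ) ⊗ₖ B)) = partialTrace (((1 : Matrix m m ℂ) ⊗ₖ B) * X) := by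
  ext i j
  simp only [partialTrace_apply, Matrix.mul_apply, Fintype.sum_prod_type, Matrix.kronecker_apply,
    Matrix.one_apply, ite_mul, mul_ite, one_mul, zero_mul, mul_zero]
  simp only [Finset.sum_ite_irrel, Finset.sum_const_zero, Finset.sum_ite_eq, Finset.sum_ite_eq',
    Finset.mem_univ, if_true]
  rw [Finset.sum_comm]
  simp only [mul_comm]

theorem posSemidef_partialTrace_mul_one_kronecker {P : Matrix (m × n) (m × n) ℂ}
    (hP : P.PosSemidef) {F : Matrix n n ℂ} (hF : F.PosSemidef) :
    (partialTrace (P * ((1 : Matrix m m ℂ) ⊗ₖ F))).PosSemidef := by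
  obtain ⟨R, rfl⟩ := hF.exists_eq_conjTranspose_mul_self
  have h : (1 : Matrix m m ℂ) ⊗ₖ (Rᴴ * R)
      = ((1 : Matrix m m ℂ) ⊗ₖ R)ᴴ * ((1 : Matrix m m ℂ) ⊗ₖ R) := by
    rw [Matrix.conjTranspose_kronecker, Matrix.conjTranspose_one, ← Matrix.mul_kronecker_mul,
      mul_one]
  rw [h, ← mul_assoc, partialTrace_mul_one_kronecker, ← mul_assoc]
  exact posSemidef_partialTrace (hP.mul_mul_conjTranspose_same _)

end PartialTrace

/-! ### Two realisations of one graph -/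

section Transfer

open scoped Kronecker

variable {W : Type*} [Fintype W] [DecidableEq W] {d d' : ℕ} {H : SimpleGraph W}
  {A : W → Matrix (Fin d) (Fin d) ℂ} {B : W → Matrix (Fin d') (Fin d') ℂ}

/-- If `A` and `B` realise the same anti-commutativity graph then the products `A w ⊗ B w` commute.
Measuring them jointly, with the second system in the (subnormalised) states `F c`, is a measurement
on the first system whose outcome averages are multiples of the `A w`. -/
theorem exists_povm_of_hasAntiCommGraph (hA : HasAntiCommGraph H A) (hB : HasAntiCommGraph H B)
    {Ω : Type*} [Fintype Ω] {F : Ω → Matrix (Fin d') (Fin d') ℂ} (hF : ∀ c, (F c).PosSemidef)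
    (hF1 : (∑ c, F c).trace = 1) :
    ∃ (P : (W → ℤˣ) × Ω → Matrix (Fin d) (Fin d) ℂ), IsPOVM P ∧
      ∀ w (g : Ω → ℂ), ∑ p : (W → ℤˣ) × Ω, (((p.1 w : ℤ) : ℂ) * g p.2) • P p
        = (B w * ∑ c, g c • F c).trace • A w := by
  have hcomm : ∀ v w, (A v ⊗ₖ B v) * (A w ⊗ₖ B w) = (A w ⊗ₖ B w) * (A v ⊗ₖ B v) := by
    intro v w
    rw [← Matrix.mul_kronecker_mul, ← Matrix.mul_kronecker_mul]
    by_cases h : H.Adj v w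
    · rw [(hA.adj_iff v w).mp h, (hB.adj_iff v w).mp h]
      ext
      simp
    · rw [hA.commute v w h, hB.commute v w h]
  obtain ⟨P, hP, hP1, hPC⟩ := exists_spectral_measure_of_commute (C := fun w => A w ⊗ₖ B w)
    (fun w => by
      rw [Matrix.IsHermitian, Matrix.conjTranspose_kronecker, hA.isHermitian, hB.isHermitian])
    (fun w => by
      rw [← Matrix.mul_kronecker_mul, hA.mul_self, hB.mul_self, Matrix.one_kronecker_one]) hcomm
  have key : ∀ (f : (W → ℤˣ) → ℂ) (g : Ω → ℂ), ∑ p : (W → ℤˣ) × Ω, (f p.1 * g p.2) •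
      partialTrace (P p.1 * ((1 : Matrix (Fin d) (Fin d) ℂ) ⊗ₖ F p.2))
      = partialTrace ((∑ s, f s • P s) * ((1 : Matrix (Fin d) (Fin d) ℂ) ⊗ₖ ∑ c, g c • F c)) := by
    intro f g
    have h1 : ((1 : Matrix (Fin d) (Fin d) ℂ) ⊗ₖ ∑ c, g c • F c)
        = ∑ c, g c • ((1 : Matrix (Fin d) (Fin d) ℂ) ⊗ₖ F c) := by
      ext
      simp [Matrix.sum_apply, Finset.mul_sum, mul_left_comm]
    rw [h1, Finset.sum_mul_sum, Fintype.sum_prod_type, map_sum]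
    refine Finset.sum_congr rfl fun s _ => ?_
    rw [map_sum]
    refine Finset.sum_congr rfl fun c _ => ?_
    rw [smul_mul_smul_comm, map_smul]
  refine ⟨fun p => partialTrace (P p.1 * ((1 : Matrix (Fin d) (Fin d) ℂ) ⊗ₖ F p.2)),
    ⟨fun p => posSemidef_partialTrace_mul_one_kronecker (hP _) (hF _), ?_⟩, fun w g => ?_⟩
  · have := key (fun _ => 1) (fun _ => 1)
    simp only [mul_one, one_smul, hP1, one_mul] at this
    rw [this, partialTrace_kronecker, hF1, one_smul]
  · rw [key (fun s => ((s w : ℤ) : ℂ)) g, hPC, ← Matrix.mul_kronecker_mul, mul_one,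
      partialTrace_kronecker]

end Transfer

/-! ### The visibilities depend on the graph only -/

section Visibilities

variable {W : Type*} {d d' : ℕ} {H : SimpleGraph W}
  {A : W → Matrix (Fin d) (Fin d) ℂ} {B : W → Matrix (Fin d') (Fin d') ℂ}

theorem one_ne_zero_matrix_fin (hd : 0 < d) : (1 : Matrix (Fin d) (Fin d) ℂ) ≠ 0 := by
  intro h
  have := congrFun (congrFun h ⟨0, hd⟩) ⟨0, hd⟩
  simp at this

theorem Matrix.trace_eq_zero_of_anticommute {n : Type*} [Fintype n] [DecidableEq n]
    {X Y : Matrix n n ℂ} (hY : Y * Y = 1) (h : X * Y = -(Y * X)) : X.trace = 0 := by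
  have h1 : X.trace = (X * Y * Y).trace := by rw [mul_assoc, hY, mul_one]
  have h2 : (X * Y * Y).trace = -X.trace := by
    rw [h, neg_mul, Matrix.trace_neg, Matrix.trace_mul_comm, ← mul_assoc, hY, one_mul]
  exact self_eq_neg.mp (h1.trans h2)

theorem HasAntiCommGraph.trace_eq_zero (hA : HasAntiCommGraph H A) {v w : W} (h : H.Adj v w) :
    (A v).trace = 0 :=
  Matrix.trace_eq_zero_of_anticommute (hA.mul_self w) ((hA.adj_iff v w).mp h)

theorem Matrix.posSemidef_one_sub_of_involution {n : Type*} [Fintype n] [DecidableEq n]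
    {X : Matrix n n ℂ} (hX : X.IsHermitian) (hsq : X * X = 1) : (1 - X).PosSemidef := by
  have h1 : (1 - X)ᴴ = 1 - X := by rw [Matrix.conjTranspose_sub, hX.eq, Matrix.conjTranspose_one]
  have h2 : 1 - X = (1 / 2 : ℂ) • ((1 - X)ᴴ * (1 - X)) := by
    rw [h1, sub_mul, mul_sub, mul_sub, hsq]
    simp only [mul_one, one_mul]
    module
  rw [h2]
  exact (Matrix.posSemidef_conjTranspose_mul_self _).smul (by
    rw [Complex.le_def]; norm_num)

/-- An expectation value of an observable with values `±1` is a real number in `[-1, 1]`. -/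
theorem exists_trace_mul_involution_eq {n : Type*} [Fintype n] [DecidableEq n]
    {X P : Matrix n n ℂ} (hX : X.IsHermitian) (hsq : X * X = 1) (hP : P.PosSemidef)
    (hP1 : P.trace = 1) : ∃ τ : ℝ, |τ| ≤ 1 ∧ (P * X).trace = τ := by
  have h1 := hP.trace_mul_nonneg (Matrix.posSemidef_one_sub_of_involution hX hsq)
  have h2 := hP.trace_mul_nonneg (Matrix.posSemidef_one_sub_of_involution (X := -X)
    (by rw [Matrix.IsHermitian, Matrix.conjTranspose_neg, hX.eq]) (by rw [neg_mul_neg, hsq]))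
  rw [mul_sub, mul_one, Matrix.trace_sub, hP1] at h1
  rw [mul_sub, mul_neg, mul_one, Matrix.trace_sub, Matrix.trace_neg, hP1, sub_neg_eq_add] at h2
  rw [Complex.le_def] at h1 h2
  simp only [Complex.zero_re, Complex.sub_re, Complex.one_re, Complex.zero_im, Complex.sub_im,
    Complex.one_im, zero_sub, Complex.add_re, Complex.add_im] at h1 h2
  refine ⟨(P * X).trace.re, abs_le.mpr ⟨by linarith [h2.1], by linarith [h1.1]⟩, ?_⟩
  apply Complex.ext
  · simp
  · simp only [Complex.ofReal_im]
    linarith [h1.2]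

theorem exists_trace_div_eq (hd : 0 < d) {X : Matrix (Fin d) (Fin d) ℂ} (hX : X.IsHermitian)
    (hsq : X * X = 1) : ∃ τ : ℝ, |τ| ≤ 1 ∧ X.trace / (d : ℂ) = τ := by
  have hd' : (d : ℂ) ≠ 0 := by exact_mod_cast hd.ne'
  obtain ⟨τ, h1, h2⟩ := exists_trace_mul_involution_eq (P := ((d : ℂ)⁻¹) • 1) hX hsq
    (Matrix.PosSemidef.one.smul (by
      rw [← Complex.ofReal_natCast, ← Complex.ofReal_inv]
      exact_mod_cast inv_nonneg.mpr (Nat.cast_nonneg d)))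
    (by rw [Matrix.trace_smul, Matrix.trace_one, Fintype.card_fin, smul_eq_mul,
      inv_mul_cancel₀ hd'])
  refine ⟨τ, h1, ?_⟩
  rw [← h2, smul_mul_assoc, one_mul, Matrix.trace_smul, smul_eq_mul, div_eq_inv_mul]

open Classical in
/-- Isolated vertices carry no constraint beyond commutation, so that their observables may be
replaced by `1`. -/
theorem HasAntiCommGraph.one_of_isolated (hd : 0 < d) (hA : HasAntiCommGraph H A) :
    HasAntiCommGraph H fun w => if ∃ v, H.Adj w v then A w else 1 := by
  have key : ∀ X : Matrix (Fin d) (Fin d) ℂ, X * X = 1 → X ≠ -X := by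
    intro X hX h
    have h0 : X = (1 / 2 : ℂ) • (X - -X) := by module
    rw [← h, sub_self, smul_zero] at h0
    rw [h0, mul_zero] at hX
    exact one_ne_zero_matrix_fin hd hX.symm
  refine ⟨fun v => ?_, fun v => ?_, fun v w => ⟨fun h => ?_, fun h => ?_⟩, fun v w h => ?_⟩
  · split_ifs
    exacts [hA.isHermitian v, Matrix.isHermitian_one]
  · split_ifs
    exacts [hA.mul_self v, mul_one 1]
  · rw [if_pos ⟨w, h⟩, if_pos ⟨v, h.symm⟩]
    exact (hA.adj_iff v w).mp h
  · split_ifs at h with hv hw hw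
    · exact (hA.adj_iff v w).mpr h
    · rw [mul_one, one_mul] at h
      exact absurd h (key _ (hA.mul_self v))
    · rw [mul_one, one_mul] at h
      exact absurd h (key _ (hA.mul_self w))
    · rw [mul_one] at h
      exact absurd h (key _ (mul_one 1))
  · split_ifs
    · exact hA.commute v w h
    all_goals simp

theorem noisyObservable_of_trace_eq_zero (t : ℝ) {X : Matrix (Fin d) (Fin d) ℂ}
    (h : X.trace = 0) : noisyObservable t X = (t : ℂ) • X := by
  simp [noisyObservable, h]

variable [Fintype W] [DecidableEq W]

/-- A parent measurement for one realisation of a graph is turned into one for any other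
realisation, by measuring the products `A w ⊗ B w` with the second system maximally mixed. The
observables at isolated vertices need not be traceless and are measured sharply on the
first system. -/
theorem compatibleVisibilities_subset (hd : 0 < d) (hd' : 0 < d') (hA : HasAntiCommGraph H A)
    (hB : HasAntiCommGraph H B) : compatibleVisibilities B ⊆ compatibleVisibilities A := by
  classical
  rintro t ⟨ht, hJ⟩
  refine ⟨ht, ?_⟩
  obtain ⟨E, hE, hEB⟩ := hJ.exists_parent
  have hd0 : (d' : ℂ) ≠ 0 := by exact_mod_cast hd'.ne'
  have hB' := hB.one_of_isolated hd'
  obtain ⟨K, hK, hKA⟩ := exists_povm_of_hasAntiCommGraph hA hB'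
    (F := fun a => (d' : ℂ)⁻¹ • E a)
    (fun a => (hE.posSemidef a).smul (by
      rw [← Complex.ofReal_natCast, ← Complex.ofReal_inv]
      exact_mod_cast inv_nonneg.mpr (Nat.cast_nonneg d')))
    (by rw [← Finset.smul_sum, hE.sum_eq_one, Matrix.trace_smul, Matrix.trace_one,
      Fintype.card_fin, smul_eq_mul, inv_mul_cancel₀ hd0])
  choose τ hτ1 hτ using fun w => exists_trace_div_eq hd (hA.isHermitian w) (hA.mul_self w)
  -- at an isolated `w` the outcome `p.1 w` is that of `A w ⊗ 1`, a sharp value of `A w`, to which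
  -- the noise of `noisyObservable t (A w)` is added classically
  refine jointlyMeasurable_of_postProcessing hK (fun w p =>
    if ∃ v, H.Adj w v then ((p.1 w : ℤ) : ℝ) * ((p.2 w : ℤ) : ℝ)
      else t * ((p.1 w : ℤ) : ℝ) + τ w * (1 - t)) (fun w p => ?_) fun w => ?_
  · have h1 : ∀ s : ℤˣ, |((s : ℤ) : ℝ)| = 1 := by
      intro s; rcases Int.units_eq_one_or s with rfl | rfl <;> simp
    split_ifs
    · rw [abs_mul, h1, h1, one_mul]
    · calc |t * ((p.1 w : ℤ) : ℝ) + τ w * (1 - t)|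
          ≤ |t * ((p.1 w : ℤ) : ℝ)| + |τ w * (1 - t)| := abs_add_le _ _
        _ = t + |τ w| * (1 - t) := by
          rw [abs_mul, abs_mul, h1, abs_of_nonneg ht.1, abs_of_nonneg (sub_nonneg.mpr ht.2),
            mul_one]
        _ ≤ t + 1 * (1 - t) := by
          gcongr
          · exact sub_nonneg.mpr ht.2
          · exact hτ1 w
        _ = 1 := by ring
  · by_cases hw : ∃ v, H.Adj w v
    · obtain ⟨v, hv⟩ := id hw
      have h2 := hKA w fun a => ((a w : ℤ) : ℂ)
      have h3 := hEB w
      rw [noisyObservable_of_trace_eq_zero t (hB.trace_eq_zero hv)] at h3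
      simp only [smul_comm _ (d' : ℂ)⁻¹, ← Finset.smul_sum] at h2
      rw [← h3, if_pos hw, mul_smul_comm, mul_smul_comm, hB.mul_self, Matrix.trace_smul,
        Matrix.trace_smul, Matrix.trace_one, Fintype.card_fin] at h2
      rw [noisyObservable_of_trace_eq_zero t (hA.trace_eq_zero hv)]
      have h4 : (d' : ℂ)⁻¹ • (t : ℂ) • (d' : ℂ) = t := by
        simp only [smul_eq_mul]; field_simp
      rw [h4] at h2
      rw [← h2]
      simp [hw]
    · have h2 := hKA w fun _ => 1
      rw [← Finset.smul_sum, if_neg hw] at h2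
      simp only [one_smul] at h2
      rw [← Finset.smul_sum, hE.sum_eq_one, one_mul, Matrix.trace_smul, Matrix.trace_one,
        Fintype.card_fin, smul_eq_mul, inv_mul_cancel₀ hd0, one_smul] at h2
      rw [noisyObservable, hτ, ← h2, ← hK.sum_eq_one, Finset.smul_sum, Finset.smul_sum,
        ← Finset.sum_add_distrib]
      refine Finset.sum_congr rfl fun p _ => ?_
      rw [if_neg hw, smul_smul, ← add_smul]
      push_cast
      simp

theorem zero_mem_compatibleVisibilities (hd : 0 < d) (hA : HasAntiCommGraph H A) :
    (0 : ℝ) ∈ compatibleVisibilities A := by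
  refine ⟨by simp, ?_⟩
  choose τ hτ1 hτ using fun w => exists_trace_div_eq hd (hA.isHermitian w) (hA.mul_self w)
  refine jointlyMeasurable_of_postProcessing (Ω := Unit) (K := fun _ => 1)
    ⟨fun _ => Matrix.PosSemidef.one, by simp⟩ (fun w _ => τ w) (fun w _ => hτ1 w) fun w => ?_
  simp [noisyObservable, hτ]

end Visibilities

/-! ### The largest visibility -/

section Compactness

variable {W : Type*} [Fintype W] [DecidableEq W] {d : ℕ}

theorem Matrix.PosSemidef.norm_apply_le {n : Type*} [Fintype n] [DecidableEq n]
    {P : Matrix n n ℂ} (hP : P.PosSemidef) (h1 : (1 - P).PosSemidef) (i j : n) : ‖P i j‖ ≤ 1 := by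
  have hdiag : ∀ k, (P k k).re ≤ 1 := by
    intro k
    have := h1.diag_nonneg (i := k)
    rw [Complex.le_def] at this
    simpa using this.1
  obtain ⟨R, rfl⟩ := hP.exists_eq_conjTranspose_mul_self
  have hre : ∀ k, ((Rᴴ * R) k k).re = ∑ l, ‖R l k‖ ^ 2 := by
    intro k
    simp only [Matrix.mul_apply, Matrix.conjTranspose_apply, Complex.re_sum]
    refine Finset.sum_congr rfl fun l _ => ?_
    rw [← Complex.normSq_eq_norm_sq, Complex.star_def, ← Complex.normSq_eq_conj_mul_self,
      Complex.ofReal_re]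
  have hi := hdiag i
  have hj := hdiag j
  rw [hre] at hi hj
  calc ‖(Rᴴ * R) i j‖ ≤ ∑ l, ‖R l i‖ * ‖R l j‖ := by
        rw [Matrix.mul_apply]
        refine (norm_sum_le _ _).trans (le_of_eq ?_)
        simp
    _ ≤ ∑ l, (‖R l i‖ ^ 2 + ‖R l j‖ ^ 2) / 2 := by
        gcongr with l
        nlinarith [sq_nonneg (‖R l i‖ - ‖R l j‖)]
    _ ≤ 1 := by
        rw [← Finset.sum_div, Finset.sum_add_distrib]
        linarith

theorem isClosed_posSemidef {n : Type*} [Fintype n] :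
    IsClosed {P : Matrix n n ℂ | P.PosSemidef} := by
  have : {P : Matrix n n ℂ | P.PosSemidef} = {P | Pᴴ = P} ∩
      ⋂ x : n → ℂ, {P | 0 ≤ star x ⬝ᵥ (P *ᵥ x)} := by
    ext P
    simp [Matrix.posSemidef_iff_dotProduct_mulVec, Matrix.IsHermitian]
  rw [this]
  refine (isClosed_eq (by fun_prop) (by fun_prop)).inter (isClosed_iInter fun x => ?_)
  exact isClosed_le continuous_const (by fun_prop)

/-- The entries of the effects of a measurement have absolute value at most one. -/
theorem isCompact_setOf_isPOVM {Ω : Type*} [Fintype Ω] :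
    IsCompact {E : Ω → Matrix (Fin d) (Fin d) ℂ | IsPOVM E} := by
  classical
  have hsub : {E : Ω → Matrix (Fin d) (Fin d) ℂ | IsPOVM E} ⊆
      Set.univ.pi fun _ => Set.univ.pi fun _ => Set.univ.pi fun _ => Metric.closedBall (0 : ℂ) 1 := by
    intro E hE c _ i _ j _
    rw [mem_closedBall_zero_iff]
    refine (hE.posSemidef c).norm_apply_le ?_ i j
    rw [← hE.sum_eq_one, ← Finset.add_sum_erase _ _ (Finset.mem_univ c), add_sub_cancel_left]
    exact Matrix.posSemidef_sum _ fun c _ => hE.posSemidef c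
  refine IsCompact.of_isClosed_subset (isCompact_univ_pi fun _ => isCompact_univ_pi fun _ =>
    isCompact_univ_pi fun _ => isCompact_closedBall _ _) ?_ hsub
  have : {E : Ω → Matrix (Fin d) (Fin d) ℂ | IsPOVM E} =
      (⋂ c, (fun E => E c) ⁻¹' {P | P.PosSemidef}) ∩ {E | ∑ c, E c = 1} := by
    ext E
    simp only [Set.mem_ofPred_eq, Set.mem_inter_iff, Set.mem_iInter, Set.mem_preimage]
    exact ⟨fun h => ⟨h.1, h.2⟩, fun h => ⟨h.1, h.2⟩⟩
  rw [this]
  refine (isClosed_iInter fun c => isClosed_posSemidef.preimage (by fun_prop)).inter ?_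
  exact isClosed_eq (by fun_prop) continuous_const

theorem isCompact_compatibleVisibilities (A : W → Matrix (Fin d) (Fin d) ℂ) :
    IsCompact (compatibleVisibilities A) := by
  have hc : IsCompact ((Set.Icc (0 : ℝ) 1 ×ˢ
      {E : (W → ℤˣ) → Matrix (Fin d) (Fin d) ℂ | IsPOVM E}) ∩
      {p | ∀ (v : W) (s : ℤˣ), binaryEffect (noisyObservable p.1 (A v)) s
        = ∑ a : W → ℤˣ with a v = s, p.2 a}) := by
    refine (isCompact_Icc.prod isCompact_setOf_isPOVM).inter_right ?_
    simp only [Set.ofPred_forall]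
    refine isClosed_iInter fun v => isClosed_iInter fun s => isClosed_eq ?_ ?_
    · unfold binaryEffect noisyObservable
      fun_prop
    · fun_prop
  convert hc.image continuous_fst using 1
  ext t
  constructor
  · rintro ⟨ht, E, hE, h⟩
    exact ⟨(t, E), ⟨⟨ht, hE⟩, h⟩, rfl⟩
  · rintro ⟨⟨t, E⟩, ⟨⟨ht, hE⟩, h⟩, rfl⟩
    exact ⟨ht, E, hE, h⟩

/-- The incompatibility robustness is the maximal visibility of every realisation. -/
theorem HasAntiCommGraph.isGreatest_incompatibilityRobustness {H : SimpleGraph W} (hd : 0 < d)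
    {A : W → Matrix (Fin d) (Fin d) ℂ} (hA : HasAntiCommGraph H A) :
    IsGreatest (compatibleVisibilities A) (incompatibilityRobustness H) := by
  have : {t | ∃ d : ℕ, 0 < d ∧ ∃ A : W → Matrix (Fin d) (Fin d) ℂ,
      HasAntiCommGraph H A ∧ t ∈ compatibleVisibilities A} = compatibleVisibilities A := by
    ext t
    constructor
    · rintro ⟨d', hd', B, hB, ht⟩
      exact compatibleVisibilities_subset hd hd' hA hB ht
    · intro ht
      exact ⟨d, hd, A, hA, ht⟩
  rw [incompatibilityRobustness, this]
  exact (isCompact_compatibleVisibilities A).isGreatest_sSup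
    ⟨0, zero_mem_compatibleVisibilities hd hA⟩

end Compactness

/-! ### Majorana operators and quadratic observables -/

section MajoranaFamilies

variable {V : Type*} {d : ℕ}

/-- The inductive step of the Jordan–Wigner construction: from `Γ` one obtains the operators
`Γ_v ⊗ σ_x` and the additional one `1 ⊗ σ_z`. -/
theorem exists_isMajoranaFamily_option
    (h : ∃ d : ℕ, 0 < d ∧ ∃ Γ : V → Matrix (Fin d) (Fin d) ℂ, IsMajoranaFamily Γ) :
    ∃ d : ℕ, 0 < d ∧ ∃ Γ : Option V → Matrix (Fin d) (Fin d) ℂ, IsMajoranaFamily Γ := by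
  obtain ⟨d, hd, Γ, hΓ⟩ := h
  let Δ : Option V → Matrix (Fin d ⊕ Fin d) (Fin d ⊕ Fin d) ℂ := fun o =>
    o.elim (Matrix.fromBlocks 1 0 0 (-1)) fun v => Matrix.fromBlocks 0 (Γ v) (Γ v) 0
  have h1 : ∀ o, (Δ o).IsHermitian := by
    rintro (_ | v)
    · simp [Δ, Matrix.IsHermitian, Matrix.fromBlocks_conjTranspose]
    · simp [Δ, Matrix.IsHermitian, Matrix.fromBlocks_conjTranspose, (hΓ.isHermitian v).eq]
  have h2 : ∀ o, Δ o * Δ o = 1 := by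
    rintro (_ | v)
    · simp [Δ, Matrix.fromBlocks_multiply]
    · simp [Δ, Matrix.fromBlocks_multiply, hΓ.mul_self]
  have h3 : ∀ o p, o ≠ p → Δ o * Δ p + Δ p * Δ o = 0 := by
    rintro (_ | v) (_ | w) hne
    · exact absurd rfl hne
    · simp [Δ, Matrix.fromBlocks_multiply, Matrix.fromBlocks_add]
    · simp [Δ, Matrix.fromBlocks_multiply, Matrix.fromBlocks_add]
    · have hvw : v ≠ w := fun h => hne (congrArg some h)
      simp [Δ, Matrix.fromBlocks_multiply, Matrix.fromBlocks_add, hΓ.anticommute v w hvw]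
  refine ⟨d + d, by omega, fun o => Matrix.reindexAlgEquiv ℂ ℂ finSumFinEquiv (Δ o),
    fun o => ?_, fun o => ?_, fun o p hne => ?_⟩
  · rw [Matrix.coe_reindexAlgEquiv, Matrix.reindex_apply]
    exact (h1 o).submatrix _
  · rw [← map_mul, h2, map_one]
  · rw [← map_mul, ← map_mul, ← map_add, h3 o p hne, map_zero]

theorem exists_isMajoranaFamily (V : Type*) [Finite V] :
    ∃ d : ℕ, 0 < d ∧ ∃ Γ : V → Matrix (Fin d) (Fin d) ℂ, IsMajoranaFamily Γ := by
  induction V using Finite.induction_empty_option with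
  | of_equiv e h =>
    obtain ⟨d, hd, Γ, hΓ⟩ := h
    exact ⟨d, hd, Γ ∘ e.symm, fun v => hΓ.isHermitian _, fun v => hΓ.mul_self _,
      fun u v huv => hΓ.anticommute _ _ fun h => huv (e.symm.injective h)⟩
  | h_empty => exact ⟨1, one_pos, fun v => v.elim, fun v => v.elim, fun v => v.elim,
      fun v => v.elim⟩
  | h_option h => exact exists_isMajoranaFamily_option h

variable {Γ : V → Matrix (Fin d) (Fin d) ℂ}

theorem IsMajoranaFamily.mul_eq_neg (hΓ : IsMajoranaFamily Γ) {u v : V} (h : u ≠ v) :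
    Γ u * Γ v = -(Γ v * Γ u) :=
  eq_neg_of_add_eq_zero_left (hΓ.anticommute u v h)

open Classical in
/-- The product `Γ_u Γ_v` anticommutes with `Γ_u` and `Γ_v` and commutes with all the others. -/
theorem IsMajoranaFamily.mul_mul_eq (hΓ : IsMajoranaFamily Γ) {u v : V} (h : u ≠ v) (x : V) :
    Γ u * Γ v * Γ x = (if x = u ∨ x = v then (-1 : ℂ) else 1) • (Γ x * (Γ u * Γ v)) := by
  by_cases hu : x = u
  · subst hu
    rw [if_pos (Or.inl rfl), mul_assoc, hΓ.mul_eq_neg h.symm, neg_one_smul, mul_neg]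
  · by_cases hv : x = v
    · subst hv
      rw [if_pos (Or.inr rfl), mul_assoc, ← mul_assoc (Γ x), hΓ.mul_eq_neg hu, neg_one_smul,
        neg_mul, neg_neg, mul_assoc]
    · rw [if_neg (not_or.mpr ⟨hu, hv⟩), one_smul, mul_assoc, hΓ.mul_eq_neg (Ne.symm hv), mul_neg,
        ← mul_assoc, hΓ.mul_eq_neg (Ne.symm hu), neg_mul, neg_neg, mul_assoc]

theorem IsMajoranaFamily.isHermitian_I_smul_mul (hΓ : IsMajoranaFamily Γ) {u v : V} (h : u ≠ v) :
    (Complex.I • (Γ u * Γ v)).IsHermitian := by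
  rw [Matrix.IsHermitian, Matrix.conjTranspose_smul, Matrix.conjTranspose_mul, hΓ.isHermitian,
    hΓ.isHermitian, hΓ.mul_eq_neg h.symm]
  simp

theorem IsMajoranaFamily.I_smul_mul_mul_self (hΓ : IsMajoranaFamily Γ) {u v : V} (h : u ≠ v) :
    Complex.I • (Γ u * Γ v) * Complex.I • (Γ u * Γ v) = 1 := by
  have : Γ u * Γ v * (Γ u * Γ v) = -1 := by
    rw [mul_assoc, ← mul_assoc (Γ v), hΓ.mul_eq_neg h.symm, neg_mul, mul_neg, mul_assoc,
      hΓ.mul_self, mul_one, hΓ.mul_self]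
  rw [smul_mul_smul_comm, this, Complex.I_mul_I, neg_one_smul, neg_neg]

theorem IsMajoranaFamily.trace_mul_eq_zero (hΓ : IsMajoranaFamily Γ) {u v : V} (h : u ≠ v) :
    (Γ u * Γ v).trace = 0 := by
  have h1 := Matrix.trace_mul_comm (Γ u) (Γ v)
  rw [hΓ.mul_eq_neg h, Matrix.trace_neg] at h1
  rw [hΓ.mul_eq_neg h, Matrix.trace_neg, neg_eq_zero]
  exact self_eq_neg.mp h1.symm

variable {G : SimpleGraph V} {A : G.edgeSet → Matrix (Fin d) (Fin d) ℂ}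

theorem IsQuadraticFamily.trace_eq_zero (hA : IsQuadraticFamily G Γ A) (hΓ : IsMajoranaFamily Γ)
    (e : G.edgeSet) : (A e).trace = 0 := by
  obtain ⟨u, v, he, hAe⟩ := hA e
  have hne : u ≠ v := G.ne_of_adj (by rw [← SimpleGraph.mem_edgeSet, ← he]; exact e.2)
  rw [hAe, Matrix.trace_smul, hΓ.trace_mul_eq_zero hne, smul_zero]

/-- The commutation sign of two quadratic observables is `(-1) ^ k`, where `k` is the number of
common endpoints; it is negative exactly for `k = 1`, that is, for distinct incident edges. -/
theorem IsQuadraticFamily.hasAntiCommGraph (hA : IsQuadraticFamily G Γ A)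
    (hΓ : IsMajoranaFamily Γ) (hd : 0 < d) : HasAntiCommGraph G.lineGraph A := by
  classical
  have hsq : ∀ e, A e * A e = 1 := by
    intro e
    obtain ⟨u, v, he, hAe⟩ := hA e
    have hne : u ≠ v := G.ne_of_adj (by rw [← SimpleGraph.mem_edgeSet, ← he]; exact e.2)
    rw [hAe, hΓ.I_smul_mul_mul_self hne]
  have hsign : ∀ e f, (G.lineGraph.Adj e f → A e * A f = -(A f * A e)) ∧
      (¬ G.lineGraph.Adj e f → A e * A f = A f * A e) := by
    intro e f
    obtain ⟨u, v, he, hAe⟩ := hA e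
    obtain ⟨x, y, hf, hAf⟩ := hA f
    have hne : u ≠ v := G.ne_of_adj (by rw [← SimpleGraph.mem_edgeSet, ← he]; exact e.2)
    have hnf : x ≠ y := G.ne_of_adj (by rw [← SimpleGraph.mem_edgeSet, ← hf]; exact f.2)
    have hmul : A e * A f = ((if x = u ∨ x = v then (-1 : ℂ) else 1) *
        (if y = u ∨ y = v then (-1 : ℂ) else 1)) • (A f * A e) := by
      rw [hAe, hAf, smul_mul_smul_comm, smul_mul_smul_comm, ← mul_assoc,
        hΓ.mul_mul_eq hne x, smul_mul_assoc, mul_assoc (Γ x), hΓ.mul_mul_eq hne y, mul_smul_comm,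
        mul_assoc (Γ x)]
      module
    have hadj : G.lineGraph.Adj e f ↔
        ¬ (s(u, v) = s(x, y)) ∧ ((x = u ∨ x = v) ∨ (y = u ∨ y = v)) := by
      rw [SimpleGraph.lineGraph_adj_iff_exists, Ne, Subtype.ext_iff, he, hf]
      simp only [Sym2.mem_iff]
      refine and_congr_right fun _ => ⟨?_, ?_⟩
      · rintro ⟨z, h1, rfl | rfl⟩
        exacts [Or.inl h1, Or.inr h1]
      · rintro (h | h)
        exacts [⟨x, h, Or.inl rfl⟩, ⟨y, h, Or.inr rfl⟩]
    rw [hadj, hmul, Sym2.eq_iff]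
    constructor
    · rintro ⟨h1, h2⟩
      have : ¬ ((x = u ∨ x = v) ∧ (y = u ∨ y = v)) := by
        rintro ⟨rfl | rfl, rfl | rfl⟩ <;> simp_all
      by_cases hx : x = u ∨ x = v
      · rw [if_pos hx, if_neg fun hy => this ⟨hx, hy⟩, mul_one, neg_one_smul]
      · rw [if_neg hx, if_pos (h2.resolve_left hx), one_mul, neg_one_smul]
    · intro h
      by_cases hx : x = u ∨ x = v
      · have hy : y = u ∨ y = v := by
          rcases hx with rfl | rfl <;> by_contra hy <;> simp_all
        rw [if_pos hx, if_pos hy, neg_one_mul, neg_neg, one_smul]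
      · have hy : ¬ (y = u ∨ y = v) := by
          intro hy
          refine h ⟨?_, Or.inr hy⟩
          rintro (⟨rfl, rfl⟩ | ⟨rfl, rfl⟩) <;> simp at hx
        rw [if_neg hx, if_neg hy, one_mul, one_smul]
  refine ⟨fun e => ?_, hsq, fun e f => ⟨(hsign e f).1, fun h => ?_⟩, fun e f => (hsign e f).2⟩
  · obtain ⟨u, v, he, hAe⟩ := hA e
    have hne : u ≠ v := G.ne_of_adj (by rw [← SimpleGraph.mem_edgeSet, ← he]; exact e.2)
    rw [hAe]
    exact hΓ.isHermitian_I_smul_mul hne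
  · by_contra hnadj
    have h0 : A e * A f = (1 / 2 : ℂ) • (A e * A f - -(A f * A e)) := by
      rw [(hsign e f).2 hnadj]; module
    rw [← h, sub_self, smul_zero] at h0
    have h1 : A e * (A e * A f) * A f = 1 := by rw [← mul_assoc, hsq, one_mul, hsq]
    rw [h0, mul_zero, zero_mul] at h1
    exact one_ne_zero_matrix_fin hd h1.symm

end MajoranaFamilies

/-! ### The top eigenvalue of a quadratic Majorana Hamiltonian -/

section Hamiltonian

variable {V : Type*} [Fintype V] {d : ℕ}

/-- The linear combination of Majorana operators with coefficient vector `φ`. -/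
def majoranaMode (Γ : V → Matrix (Fin d) (Fin d) ℂ) (φ : V → ℂ) : Matrix (Fin d) (Fin d) ℂ :=
  ∑ u, φ u • Γ u

/-- The quadratic Hamiltonian `(1 / 2) ∑ h u v Γ_u Γ_v`. -/
noncomputable def quadraticHamiltonian (Γ : V → Matrix (Fin d) (Fin d) ℂ) (h : Matrix V V ℂ) :
    Matrix (Fin d) (Fin d) ℂ :=
  (1 / 2 : ℂ) • ∑ u, ∑ v, h u v • (Γ u * Γ v)

variable {Γ : V → Matrix (Fin d) (Fin d) ℂ}

theorem IsMajoranaFamily.conjTranspose_mode (hΓ : IsMajoranaFamily Γ) (φ : V → ℂ) :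
    (majoranaMode Γ φ)ᴴ = majoranaMode Γ (star φ) := by
  simp [majoranaMode, Matrix.conjTranspose_sum, Matrix.conjTranspose_smul,
    (hΓ.isHermitian _).eq]

theorem majoranaMode_mul (φ χ : V → ℂ) : majoranaMode Γ φ * majoranaMode Γ χ
    = ∑ u, ∑ v, (φ u * χ v) • (Γ u * Γ v) := by
  simp only [majoranaMode, Finset.sum_mul_sum, smul_mul_smul_comm]

theorem dotProduct_eq_zero_of_skew {h : Matrix V V ℂ} (hskew : hᵀ = -h) {φ χ : V → ℂ} {a b : ℂ}
    (hφ : h *ᵥ φ = a • φ) (hχ : h *ᵥ χ = b • χ) (hab : a + b ≠ 0) : φ ⬝ᵥ χ = 0 := by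
  have h1 : φ ⬝ᵥ (h *ᵥ χ) = -((h *ᵥ φ) ⬝ᵥ χ) := by
    rw [Matrix.dotProduct_mulVec, ← Matrix.mulVec_transpose, hskew, Matrix.neg_mulVec,
      neg_dotProduct]
  rw [hφ, hχ, dotProduct_smul, smul_dotProduct, smul_eq_mul, smul_eq_mul] at h1
  have h2 : (a + b) * φ ⬝ᵥ χ = 0 := by linear_combination h1
  exact (mul_eq_zero.mp h2).resolve_left hab

variable [DecidableEq V]

/-- The canonical anti-commutation relations. -/
theorem IsMajoranaFamily.mode_anticommutator (hΓ : IsMajoranaFamily Γ) (φ χ : V → ℂ) :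
    majoranaMode Γ φ * majoranaMode Γ χ + majoranaMode Γ χ * majoranaMode Γ φ
      = (2 * φ ⬝ᵥ χ) • (1 : Matrix (Fin d) (Fin d) ℂ) := by
  rw [majoranaMode_mul, majoranaMode_mul, Finset.sum_comm (s := Finset.univ (α := V)),
    ← Finset.sum_add_distrib]
  simp only [← Finset.sum_add_distrib]
  have h1 : ∀ u v, (φ v * χ u) • (Γ v * Γ u) + (χ u * φ v) • (Γ u * Γ v)
      = if u = v then (2 * (φ u * χ u)) • (1 : Matrix (Fin d) (Fin d) ℂ) else 0 := by
    intro u v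
    split_ifs with huv
    · subst huv
      rw [hΓ.mul_self]
      module
    · rw [mul_comm (χ u), ← smul_add, add_comm, hΓ.anticommute u v huv, smul_zero]
  simp only [h1, Finset.sum_ite_eq, Finset.mem_univ, if_true]
  rw [← Finset.sum_smul, ← Finset.mul_sum]
  rfl

/-- Pairwise anticommuting nilpotent matrices have a common null vector: as long as some `c i` does
not kill `x`, replace `x` by `c i x`. -/
theorem exists_common_null_vector {ι n : Type*} [Fintype n] [Nonempty n]
    {c : ι → Matrix n n ℂ} (hc : ∀ i j, c i * c j + c j * c i = 0) (s : Finset ι) :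
    ∃ x : n → ℂ, x ≠ 0 ∧ ∀ i ∈ s, c i *ᵥ x = 0 := by
  classical
  induction s using Finset.induction_on with
  | empty =>
    obtain ⟨x, hx⟩ := exists_ne (0 : n → ℂ)
    exact ⟨x, hx, by simp⟩
  | insert i s _ ih =>
    obtain ⟨x, hx, hs⟩ := ih
    by_cases hi : c i *ᵥ x = 0
    · refine ⟨x, hx, fun j hj => ?_⟩
      rcases Finset.mem_insert.mp hj with rfl | hj
      exacts [hi, hs j hj]
    · refine ⟨c i *ᵥ x, hi, fun j hj => ?_⟩
      have hji : c j * c i = -(c i * c j) := eq_neg_of_add_eq_zero_left (hc j i)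
      rcases Finset.mem_insert.mp hj with rfl | hj
      · have h0 : c j * c j = (1 / 2 : ℂ) • (c j * c j + c j * c j) := by module
        rw [hc, smul_zero] at h0
        rw [Matrix.mulVec_mulVec, h0, Matrix.zero_mulVec]
      · rw [Matrix.mulVec_mulVec, hji, Matrix.neg_mulVec, ← Matrix.mulVec_mulVec, hs j hj,
          Matrix.mulVec_zero, neg_zero]

variable {h : Matrix V V ℂ}

theorem eigenvectorBasis_dotProduct_star (hh : h.IsHermitian) (k : V) :
    (fun u => hh.eigenvectorBasis k u) ⬝ᵥ star (fun u => hh.eigenvectorBasis k u) = 1 := by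
  have h1 := inner_self_eq_norm_sq_to_K (𝕜 := ℂ) (hh.eigenvectorBasis k)
  rw [hh.eigenvectorBasis.orthonormal.1 k, EuclideanSpace.inner_eq_star_dotProduct] at h1
  simpa using h1

theorem quadraticHamiltonian_eq_sum_modes (hh : h.IsHermitian) :
    quadraticHamiltonian Γ h = (1 / 2 : ℂ) • ∑ k, (hh.eigenvalues k : ℂ) •
      (majoranaMode Γ (fun u => hh.eigenvectorBasis k u) *
        majoranaMode Γ (star fun u => hh.eigenvectorBasis k u)) := by
  have hentry : ∀ u v, h u v = ∑ k, (hh.eigenvalues k : ℂ) *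
      (hh.eigenvectorBasis k u * star (hh.eigenvectorBasis k v)) := by
    intro u v
    conv_lhs => rw [hh.spectral_theorem, Unitary.conjStarAlgAut_apply]
    rw [Matrix.mul_apply]
    refine Finset.sum_congr rfl fun k _ => ?_
    rw [Matrix.mul_diagonal, Matrix.star_apply, hh.eigenvectorUnitary_apply,
      hh.eigenvectorUnitary_apply]
    simp only [Function.comp_apply, Complex.coe_algebraMap, RCLike.ofReal]
    ring
  rw [quadraticHamiltonian]
  congr 1
  simp only [majoranaMode_mul, hentry, Finset.sum_smul, Finset.smul_sum, smul_smul]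
  have : ∀ u : V, ∑ v, ∑ k, ((hh.eigenvalues k : ℂ) *
      (hh.eigenvectorBasis k u * star (hh.eigenvectorBasis k v))) • (Γ u * Γ v)
      = ∑ k, ∑ v, ((hh.eigenvalues k : ℂ) *
      (hh.eigenvectorBasis k u * star (hh.eigenvectorBasis k v))) • (Γ u * Γ v) :=
    fun u => Finset.sum_comm
  simp only [this]
  rw [Finset.sum_comm]
  rfl

theorem sum_eigenvalues_eq_zero_of_skew (hh : h.IsHermitian) (hskew : hᵀ = -h) :
    ∑ k, hh.eigenvalues k = 0 := by
  have h1 := hh.trace_eq_sum_eigenvalues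
  have h2 : h.trace = 0 := by
    have h3 := congrArg Matrix.trace hskew
    rw [Matrix.trace_transpose, Matrix.trace_neg] at h3
    exact self_eq_neg.mp h3
  rw [h2] at h1
  have h4 : ((∑ k, hh.eigenvalues k : ℝ) : ℂ) = 0 := by
    push_cast
    exact h1.symm
  exact_mod_cast h4

/-- The Hamiltonian is at most half the trace norm of its coefficient matrix, since
`0 ≤ c cᴴ ≤ 2` for every normalised mode `c`. -/
theorem IsMajoranaFamily.posSemidef_sub_quadraticHamiltonian (hΓ : IsMajoranaFamily Γ)
    (hh : h.IsHermitian) (hskew : hᵀ = -h) :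
    ((((1 / 2 * ∑ k, |hh.eigenvalues k| : ℝ) : ℂ)) • (1 : Matrix (Fin d) (Fin d) ℂ)
      - quadraticHamiltonian Γ h).PosSemidef := by
  set ψ : V → V → ℂ := fun k u => hh.eigenvectorBasis k u with hψ
  have hsum : (((1 / 2 * ∑ k, |hh.eigenvalues k| : ℝ) : ℂ)) • (1 : Matrix (Fin d) (Fin d) ℂ)
      - quadraticHamiltonian Γ h = ∑ k, (1 / 2 : ℂ) •
        ((((|hh.eigenvalues k| + hh.eigenvalues k : ℝ) : ℂ)) • (1 : Matrix (Fin d) (Fin d) ℂ)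
          - (hh.eigenvalues k : ℂ) • (majoranaMode Γ (ψ k) * majoranaMode Γ (star (ψ k)))) := by
    rw [quadraticHamiltonian_eq_sum_modes hh, ← Finset.smul_sum, Finset.sum_sub_distrib,
      ← Finset.sum_smul, ← Complex.ofReal_sum, Finset.sum_add_distrib,
      sum_eigenvalues_eq_zero_of_skew hh hskew, add_zero, smul_sub, smul_smul]
    push_cast
    rfl
  rw [hsum]
  refine Matrix.posSemidef_sum _ fun k _ => Matrix.PosSemidef.smul ?_
    (by rw [Complex.le_def]; norm_num)
  have hstar : (majoranaMode Γ (star (ψ k)))ᴴ = majoranaMode Γ (ψ k) := by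
    rw [hΓ.conjTranspose_mode, star_star]
  rcases le_total 0 (hh.eigenvalues k) with hk | hk
  · have h1 := hΓ.mode_anticommutator (ψ k) (star (ψ k))
    rw [eigenvectorBasis_dotProduct_star hh k, mul_one] at h1
    have h2 : (((|hh.eigenvalues k| + hh.eigenvalues k : ℝ) : ℂ)) • (1 : Matrix (Fin d) (Fin d) ℂ)
        - (hh.eigenvalues k : ℂ) • (majoranaMode Γ (ψ k) * majoranaMode Γ (star (ψ k)))
        = (hh.eigenvalues k : ℂ) • ((majoranaMode Γ (ψ k))ᴴ * majoranaMode Γ (ψ k)) := by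
      rw [hΓ.conjTranspose_mode, ← sub_eq_zero, abs_of_nonneg hk]
      rw [eq_comm, ← sub_eq_zero] at h1
      calc _ = (hh.eigenvalues k : ℂ) • ((2 : ℂ) • (1 : Matrix (Fin d) (Fin d) ℂ) -
            (majoranaMode Γ (ψ k) * majoranaMode Γ (star (ψ k)) +
              majoranaMode Γ (star (ψ k)) * majoranaMode Γ (ψ k))) := by
            push_cast; module
        _ = 0 := by rw [h1, smul_zero]
    rw [h2]
    exact (Matrix.posSemidef_conjTranspose_mul_self _).smul (by exact_mod_cast hk)
  · have h2 : (((|hh.eigenvalues k| + hh.eigenvalues k : ℝ) : ℂ)) • (1 : Matrix (Fin d) (Fin d) ℂ)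
        - (hh.eigenvalues k : ℂ) • (majoranaMode Γ (ψ k) * majoranaMode Γ (star (ψ k)))
        = ((-hh.eigenvalues k : ℝ) : ℂ) •
          ((majoranaMode Γ (star (ψ k)))ᴴ * majoranaMode Γ (star (ψ k))) := by
      rw [hstar, abs_of_nonpos hk]
      push_cast
      module
    rw [h2]
    exact (Matrix.posSemidef_conjTranspose_mul_self _).smul
      (by exact_mod_cast neg_nonneg.mpr hk)

/-- The bound by half the trace norm is attained by the vacuum: a vector killed by the modes of
positive energy `c` and by the adjoints of the modes of negative energy. -/
theorem IsMajoranaFamily.exists_top_eigenvector (hΓ : IsMajoranaFamily Γ) (hd : 0 < d)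
    (hh : h.IsHermitian) (hskew : hᵀ = -h) :
    ∃ x : Fin d → ℂ, x ≠ 0 ∧ quadraticHamiltonian Γ h *ᵥ x
      = ((1 / 2 * ∑ k, |hh.eigenvalues k| : ℝ) : ℂ) • x := by
  have : Nonempty (Fin d) := ⟨⟨0, hd⟩⟩
  set ψ : V → V → ℂ := fun k u => hh.eigenvectorBasis k u with hψ
  have hψe : ∀ k, h *ᵥ ψ k = (hh.eigenvalues k : ℂ) • ψ k := fun k =>
    hh.mulVec_eigenvectorBasis k
  have hψs : ∀ k, h *ᵥ star (ψ k) = -(hh.eigenvalues k : ℂ) • star (ψ k) := by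
    intro k
    have h1 := congrArg star (hψe k)
    rw [Matrix.star_mulVec, hh.eq, ← Matrix.mulVec_transpose, hskew, Matrix.neg_mulVec,
      star_smul] at h1
    rw [neg_smul, ← neg_eq_iff_eq_neg, h1]
    simp
  -- complex conjugation exchanges the eigenvalues `λ` and `-λ`, so `φ k` has eigenvalue `|λ k|`; by
  -- antisymmetry of `h` the modes `φ k` with `λ k ≠ 0` then anticommute
  let φ : V → V → ℂ := fun k => if 0 < hh.eigenvalues k then ψ k else star (ψ k)
  have hφe : ∀ k, h *ᵥ φ k = ((|hh.eigenvalues k| : ℝ) : ℂ) • φ k := by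
    intro k
    simp only [φ]
    split_ifs with hk
    · rw [hψe, abs_of_pos hk]
    · rw [hψs, abs_of_nonpos (not_lt.mp hk)]
      push_cast
      rfl
  obtain ⟨x, hx, hvac⟩ := exists_common_null_vector
    (c := fun k : {k // hh.eigenvalues k ≠ 0} => majoranaMode Γ (φ k)) (fun j k => by
      rw [hΓ.mode_anticommutator, dotProduct_eq_zero_of_skew hskew (hφe j) (hφe k), mul_zero,
        zero_smul]
      have := add_pos (abs_pos.mpr j.2) (abs_pos.mpr k.2)
      exact_mod_cast this.ne') Finset.univ
  have hvac' : ∀ k, hh.eigenvalues k ≠ 0 → majoranaMode Γ (φ k) *ᵥ x = 0 :=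
    fun k hk => hvac ⟨k, hk⟩ (Finset.mem_univ _)
  have hmode : ∀ k, ((hh.eigenvalues k : ℂ) •
      (majoranaMode Γ (ψ k) * majoranaMode Γ (star (ψ k)))) *ᵥ x
      = ((|hh.eigenvalues k| + hh.eigenvalues k : ℝ) : ℂ) • x := by
    intro k
    rcases lt_trichotomy (hh.eigenvalues k) 0 with hk | hk | hk
    · have h1 := hvac' k hk.ne
      simp only [φ, if_neg hk.not_gt] at h1
      rw [Matrix.smul_mulVec, ← Matrix.mulVec_mulVec, h1, abs_of_neg hk]
      simp
    · simp [hk]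
    · have h1 := hvac' k hk.ne'
      simp only [φ, if_pos hk] at h1
      have h2 := hΓ.mode_anticommutator (ψ k) (star (ψ k))
      rw [eigenvectorBasis_dotProduct_star hh k, mul_one, ← eq_sub_iff_add_eq] at h2
      rw [Matrix.smul_mulVec, h2, Matrix.sub_mulVec, ← Matrix.mulVec_mulVec, h1,
        Matrix.mulVec_zero, sub_zero, Matrix.smul_mulVec, Matrix.one_mulVec, abs_of_pos hk]
      push_cast
      module
  refine ⟨x, hx, ?_⟩
  rw [quadraticHamiltonian_eq_sum_modes hh, Matrix.smul_mulVec, Matrix.sum_mulVec,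
    Finset.sum_congr rfl fun k _ => hmode k, ← Finset.sum_smul, ← Complex.ofReal_sum,
    Finset.sum_add_distrib, sum_eigenvalues_eq_zero_of_skew hh hskew, add_zero, smul_smul]
  push_cast
  rfl

end Hamiltonian

/-! ### Skew-energy and quadratic observables -/

section SkewEnergy

variable {V : Type*} {G : SimpleGraph V} {d : ℕ}

instance finite_graphOrientation [Finite V] : Finite (GraphOrientation G) := by
  classical
  have := Fintype.ofFinite V
  have : Finite G.Dart := Finite.of_injective SimpleGraph.Dart.toProd
    SimpleGraph.Dart.toProd_injective
  unfold GraphOrientation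
  infer_instance

/-- A representative dart of an edge. -/
noncomputable def edgeDart (e : G.edgeSet) : G.Dart :=
  ⟨(e : Sym2 V).out, by
    rw [← SimpleGraph.mem_edgeSet]
    exact (congrArg (· ∈ G.edgeSet) (Quot.out_eq (e : Sym2 V))).mpr e.2⟩

theorem edgeDart_edge (e : G.edgeSet) : (edgeDart e).edge = e := Quot.out_eq (e : Sym2 V)

theorem eq_edgeDart_or_symm (e : G.Dart) :
    e = edgeDart ⟨e.edge, e.edge_mem⟩ ∨ e = (edgeDart ⟨e.edge, e.edge_mem⟩).symm :=
  SimpleGraph.dart_edge_eq_iff _ _ |>.mp (edgeDart_edge ⟨e.edge, e.edge_mem⟩).symm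

instance nonempty_graphOrientation : Nonempty (GraphOrientation G) := by
  classical
  refine ⟨⟨fun e => if e = edgeDart ⟨e.edge, e.edge_mem⟩ then 1 else -1, fun e => ?_⟩⟩
  have h1 : edgeDart ⟨e.symm.edge, e.symm.edge_mem⟩ = edgeDart ⟨e.edge, e.edge_mem⟩ := by
    congr 2
    exact SimpleGraph.Dart.edge_symm e
  simp only [h1]
  rcases eq_edgeDart_or_symm e with h | h
  · rw [if_pos h, ← h, if_neg e.symm_ne]
  · have h2 : edgeDart ⟨e.edge, e.edge_mem⟩ = e.symm := by
      conv_rhs => rw [h, SimpleGraph.Dart.symm_symm]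
    rw [h2, if_pos rfl, if_neg e.symm_ne.symm, neg_neg]

/-- The orientation obtained from `σ` by reversing the edges with sign `-1`. -/
def GraphOrientation.twist (σ : GraphOrientation G) (a : G.edgeSet → ℤˣ) : GraphOrientation G :=
  ⟨fun e => a ⟨e.edge, e.edge_mem⟩ * σ.1 e, fun e => by
    have h1 : (⟨e.symm.edge, e.symm.edge_mem⟩ : G.edgeSet) = ⟨e.edge, e.edge_mem⟩ :=
      Subtype.ext (SimpleGraph.Dart.edge_symm e)
    change a ⟨e.symm.edge, e.symm.edge_mem⟩ * σ.1 e.symm = -(a ⟨e.edge, e.edge_mem⟩ * σ.1 e)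
    rw [h1, show σ.1 e.symm = -σ.1 e from σ.2 e, mul_neg]⟩

/-- The quadratic observable `i Γ_u Γ_v` of the edge `{u, v}`, where `u → v` in the
orientation `σ`. -/
noncomputable def orientedObservable (σ : GraphOrientation G) (Γ : V → Matrix (Fin d) (Fin d) ℂ)
    (e : G.edgeSet) : Matrix (Fin d) (Fin d) ℂ :=
  (((σ.1 (edgeDart e) : ℤ) : ℂ) * Complex.I) • (Γ (edgeDart e).fst * Γ (edgeDart e).snd)

variable {Γ : V → Matrix (Fin d) (Fin d) ℂ}

theorem IsMajoranaFamily.orientedObservable_edge (hΓ : IsMajoranaFamily Γ)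
    (σ : GraphOrientation G) (e : G.Dart) : orientedObservable σ Γ ⟨e.edge, e.edge_mem⟩
      = (((σ.1 e : ℤ) : ℂ) * Complex.I) • (Γ e.fst * Γ e.snd) := by
  unfold orientedObservable
  rcases eq_edgeDart_or_symm e with h | h
  · rw [← h]
  · have h2 : edgeDart ⟨e.edge, e.edge_mem⟩ = e.symm := by
      conv_rhs => rw [h, SimpleGraph.Dart.symm_symm]
    rw [h2, σ.2]
    change _ • (Γ e.snd * Γ e.fst) = _
    rw [hΓ.mul_eq_neg e.adj.ne']
    push_cast
    module

theorem orientedObservable_twist (σ : GraphOrientation G) (a : G.edgeSet → ℤˣ) (e : G.edgeSet) :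
    orientedObservable (σ.twist a) Γ e = ((a e : ℤ) : ℂ) • orientedObservable σ Γ e := by
  have h1 : (⟨(edgeDart e).edge, (edgeDart e).edge_mem⟩ : G.edgeSet) = e :=
    Subtype.ext (edgeDart_edge e)
  simp only [orientedObservable, GraphOrientation.twist, h1, smul_smul]
  push_cast
  ring_nf

theorem IsMajoranaFamily.isQuadraticFamily_orientedObservable (hΓ : IsMajoranaFamily Γ)
    (σ : GraphOrientation G) : IsQuadraticFamily G Γ (orientedObservable σ Γ) := by
  intro e
  have h1 : (e : Sym2 V) = s((edgeDart e).fst, (edgeDart e).snd) := (edgeDart_edge e).symm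
  rcases Int.units_eq_one_or (σ.1 (edgeDart e)) with h | h
  · exact ⟨_, _, h1, by simp [orientedObservable, h]⟩
  · refine ⟨_, _, h1.trans Sym2.eq_swap, ?_⟩
    rw [hΓ.mul_eq_neg (edgeDart e).adj.ne']
    simp [orientedObservable, h]

variable [DecidableRel G.Adj]

/-- `i` times the skew-adjacency matrix, a Hermitian matrix. -/
noncomputable def hermitianAdjMatrix (G : SimpleGraph V) [DecidableRel G.Adj]
    (σ : GraphOrientation G) : Matrix V V ℂ :=
  Complex.I • (skewAdjMatrix G σ).map (algebraMap ℝ ℂ)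

theorem skewAdjMatrix_transpose (σ : GraphOrientation G) :
    (skewAdjMatrix G σ)ᵀ = -skewAdjMatrix G σ := by
  ext u v
  simp only [skewAdjMatrix, Matrix.transpose_apply, Matrix.of_apply, Matrix.neg_apply]
  by_cases h : G.Adj u v
  · rw [dif_pos h, dif_pos h.symm]
    have := σ.2 ⟨(u, v), h⟩
    have h2 : (⟨(u, v), h⟩ : G.Dart).symm = ⟨(v, u), h.symm⟩ := rfl
    rw [h2] at this
    rw [this]
    push_cast
    rfl
  · rw [dif_neg h, dif_neg fun h' => h h'.symm, neg_zero]

theorem hermitianAdjMatrix_transpose (σ : GraphOrientation G) :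
    (hermitianAdjMatrix G σ)ᵀ = -hermitianAdjMatrix G σ := by
  rw [hermitianAdjMatrix, Matrix.transpose_smul, ← Matrix.transpose_map, skewAdjMatrix_transpose]
  ext
  simp

theorem isHermitian_hermitianAdjMatrix (σ : GraphOrientation G) :
    (hermitianAdjMatrix G σ).IsHermitian := by
  have h := hermitianAdjMatrix_transpose σ
  ext u v
  have h1 := congrFun (congrFun h u) v
  rw [Matrix.conjTranspose_apply]
  rw [Matrix.transpose_apply, Matrix.neg_apply] at h1
  rw [h1]
  simp [hermitianAdjMatrix]

open Polynomial in
/-- The spectrum of a multiple of a Hermitian matrix, with multiplicities. -/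
theorem Matrix.IsHermitian.roots_charpoly_smul {n : Type*} [Fintype n] [DecidableEq n]
    {h : Matrix n n ℂ} (hh : h.IsHermitian) (z : ℂ) :
    (z • h).charpoly.roots = Finset.univ.val.map fun k => z * (hh.eigenvalues k : ℂ) := by
  have h1 : (z • h).charpoly = ∏ k, (X - C (z * (hh.eigenvalues k : ℂ))) := by
    conv_lhs => rw [hh.spectral_theorem, Unitary.conjStarAlgAut_apply, ← smul_mul_assoc,
      ← mul_smul_comm, Matrix.charpoly_mul_comm, ← mul_assoc]
    simp [← Matrix.diagonal_smul, Matrix.charpoly_diagonal]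
  rw [h1, Polynomial.roots_prod]
  · simp only [Polynomial.roots_X_sub_C, Multiset.bind_singleton]
  · exact Finset.prod_ne_zero_iff.mpr fun k _ => Polynomial.X_sub_C_ne_zero _

variable [Fintype V] [DecidableEq V]

theorem skewEnergy_eq_sum_abs_eigenvalues (σ : GraphOrientation G) :
    skewEnergy G σ = ∑ k, |(isHermitian_hermitianAdjMatrix σ).eigenvalues k| := by
  have h1 : (skewAdjMatrix G σ).map (algebraMap ℝ ℂ)
      = (-Complex.I) • hermitianAdjMatrix G σ := by
    rw [hermitianAdjMatrix, smul_smul]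
    simp
  rw [skewEnergy, h1, (isHermitian_hermitianAdjMatrix σ).roots_charpoly_smul, Multiset.map_map]
  simp

theorem sum_darts_eq_two_nsmul_sum_edges {M : Type*} [AddCommMonoid M] (F : G.edgeSet → M) :
    ∑ e : G.Dart, F ⟨e.edge, e.edge_mem⟩ = 2 • ∑ e, F e := by
  rw [← Finset.sum_fiberwise Finset.univ (fun e : G.Dart => (⟨e.edge, e.edge_mem⟩ : G.edgeSet)),
    Finset.smul_sum]
  refine Finset.sum_congr rfl fun e _ => ?_
  rw [Finset.sum_congr rfl fun e' he' => congrArg F (Finset.mem_filter.mp he').2,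
    Finset.sum_const, ← G.dart_edge_fiber_card e e.2]
  congr 2
  ext e'
  simp [Subtype.ext_iff]

/-- The sum of the quadratic observables along an orientation is the Hamiltonian of its
skew-adjacency matrix. -/
theorem IsMajoranaFamily.sum_orientedObservable (hΓ : IsMajoranaFamily Γ)
    (σ : GraphOrientation G) :
    ∑ e, orientedObservable σ Γ e = quadraticHamiltonian Γ (hermitianAdjMatrix G σ) := by
  have h1 := sum_darts_eq_two_nsmul_sum_edges (orientedObservable σ Γ)
  have h2 : ∑ e : G.Dart, orientedObservable σ Γ ⟨e.edge, e.edge_mem⟩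
      = ∑ p : V × V, hermitianAdjMatrix G σ p.1 p.2 • (Γ p.1 * Γ p.2) := by
    refine Fintype.sum_of_injective SimpleGraph.Dart.toProd
      SimpleGraph.Dart.toProd_injective _ _ (fun p hp => ?_) fun e => ?_
    · have : ¬ G.Adj p.1 p.2 := fun h => hp ⟨⟨p, h⟩, rfl⟩
      simp [hermitianAdjMatrix, skewAdjMatrix, this]
    · rw [hΓ.orientedObservable_edge]
      simp [hermitianAdjMatrix, skewAdjMatrix, mul_comm]
  rw [quadraticHamiltonian, ← Fintype.sum_prod_type', ← h2, h1, two_nsmul]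
  module

theorem skewEnergy_le_maxSkewEnergy (σ : GraphOrientation G) : skewEnergy G σ ≤ maxSkewEnergy G :=
  le_ciSup (Set.finite_range _).bddAbove σ

theorem exists_skewEnergy_eq_max (G : SimpleGraph V) [DecidableRel G.Adj] :
    ∃ σ : GraphOrientation G, skewEnergy G σ = maxSkewEnergy G :=
  exists_eq_ciSup_of_finite

end SkewEnergy

/-! ### The skew-energy bound and edge-transitive graphs -/

section Robustness

variable {V : Type*} [Fintype V] [DecidableEq V] {G : SimpleGraph V} [DecidableRel G.Adj] {d : ℕ}
  {Γ : V → Matrix (Fin d) (Fin d) ℂ}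

/-- Every sign pattern `a` of the observables is an orientation, so that the correlation
`∑ a_e A_e` is bounded by the maximal skew-energy. -/
theorem le_maxSkewEnergy_of_mem_compatibleVisibilities (hE : G.edgeSet.Nonempty) (hd : 0 < d)
    (hΓ : IsMajoranaFamily Γ) (σ : GraphOrientation G) {t : ℝ}
    (ht : t ∈ compatibleVisibilities (orientedObservable σ Γ)) :
    t ≤ maxSkewEnergy G / (2 * (G.edgeFinset.card : ℝ)) := by
  have hA := hΓ.isQuadraticFamily_orientedObservable σ
  have hG := hA.hasAntiCommGraph hΓ hd
  obtain ⟨E, hP, hN⟩ := ht.2.exists_parent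
  have hcard : 0 < (G.edgeFinset.card : ℝ) := by
    exact_mod_cast Finset.card_pos.mpr (SimpleGraph.edgeFinset_nonempty.mpr
      (SimpleGraph.edgeSet_nonempty.mp hE))
  have hdR : (0 : ℝ) < d := by exact_mod_cast hd
  have hlhs : ∀ e, (noisyObservable t (orientedObservable σ Γ e) * orientedObservable σ Γ e).trace
      = ((t * d : ℝ) : ℂ) := by
    intro e
    rw [noisyObservable_of_trace_eq_zero t (hA.trace_eq_zero hΓ e), smul_mul_assoc, hG.mul_self,
      Matrix.trace_smul, Matrix.trace_one, Fintype.card_fin]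
    simp
  have hsum : ((G.edgeFinset.card * (t * d) : ℝ) : ℂ) = ∑ a, (E a *
      quadraticHamiltonian Γ (hermitianAdjMatrix G (σ.twist a))).trace := by
    calc ((G.edgeFinset.card * (t * d) : ℝ) : ℂ)
        = ∑ e : G.edgeSet, ((t * d : ℝ) : ℂ) := by
          rw [Finset.sum_const, Finset.card_univ, ← SimpleGraph.edgeFinset_card, nsmul_eq_mul]
          push_cast
          rfl
      _ = ∑ e : G.edgeSet, ∑ a, (E a * orientedObservable (σ.twist a) Γ e).trace := by
          refine Finset.sum_congr rfl fun e _ => ?_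
          rw [← hlhs e, hN e, Finset.sum_mul, Matrix.trace_sum]
          refine Finset.sum_congr rfl fun a _ => ?_
          rw [orientedObservable_twist, mul_smul_comm, smul_mul_assoc]
      _ = _ := by
          rw [Finset.sum_comm]
          refine Finset.sum_congr rfl fun a _ => ?_
          rw [← hΓ.sum_orientedObservable, Finset.mul_sum, Matrix.trace_sum]
  have hbound : ∀ a, (E a * quadraticHamiltonian Γ (hermitianAdjMatrix G (σ.twist a))).trace
      ≤ ((1 / 2 * maxSkewEnergy G : ℝ) : ℂ) * (E a).trace := by
    intro a
    have h1 := (hP.posSemidef a).trace_mul_nonneg (hΓ.posSemidef_sub_quadraticHamiltonian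
      (isHermitian_hermitianAdjMatrix (σ.twist a)) (hermitianAdjMatrix_transpose (σ.twist a)))
    rw [← skewEnergy_eq_sum_abs_eigenvalues, mul_sub, Matrix.trace_sub, mul_smul_comm, mul_one,
      Matrix.trace_smul, smul_eq_mul, sub_nonneg] at h1
    refine h1.trans (mul_le_mul_of_nonneg_right ?_ (hP.posSemidef a).trace_nonneg)
    have := skewEnergy_le_maxSkewEnergy (σ.twist a)
    exact_mod_cast (by linarith : 1 / 2 * skewEnergy G (σ.twist a) ≤ 1 / 2 * maxSkewEnergy G)
  have hfin : ((G.edgeFinset.card * (t * d) : ℝ) : ℂ) ≤ ((1 / 2 * maxSkewEnergy G * d : ℝ) : ℂ) := by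
    rw [hsum]
    refine (Finset.sum_le_sum fun a _ => hbound a).trans (le_of_eq ?_)
    rw [← Finset.mul_sum, ← Matrix.trace_sum, hP.sum_eq_one, Matrix.trace_one, Fintype.card_fin]
    push_cast
    rfl
  have hfin' : G.edgeFinset.card * (t * d) ≤ 1 / 2 * maxSkewEnergy G * d := by
    exact_mod_cast hfin
  rw [le_div_iff₀ (by positivity)]
  have h2 : (G.edgeFinset.card * t) * d ≤ (1 / 2 * maxSkewEnergy G) * d := by linarith
  have := le_of_mul_le_mul_right h2 hdR
  linarith

/-- For a suitable orientation there is a state with total correlation `maxSkewEnergy G / 2`. -/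
theorem IsMajoranaFamily.exists_state (hΓ : IsMajoranaFamily Γ) (hd : 0 < d)
    {σ : GraphOrientation G} (hσ : skewEnergy G σ = maxSkewEnergy G) :
    ∃ ρ : Matrix (Fin d) (Fin d) ℂ, ρ.PosSemidef ∧ ρ.trace = 1 ∧
      ∑ e, (ρ * orientedObservable σ Γ e).trace = ((1 / 2 * maxSkewEnergy G : ℝ) : ℂ) := by
  obtain ⟨x, hx, hHx⟩ := hΓ.exists_top_eigenvector hd (isHermitian_hermitianAdjMatrix σ)
    (hermitianAdjMatrix_transpose σ)
  rw [← skewEnergy_eq_sum_abs_eigenvalues, hσ] at hHx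
  have hpos : 0 < x ⬝ᵥ star x := Matrix.dotProduct_self_star_pos_iff.mpr hx
  refine ⟨(x ⬝ᵥ star x)⁻¹ • Matrix.vecMulVec x (star x),
    (Matrix.posSemidef_vecMulVec_self_star x).smul (inv_nonneg.mpr hpos.le), ?_, ?_⟩
  · rw [Matrix.trace_smul, Matrix.trace_vecMulVec, smul_eq_mul, inv_mul_cancel₀ hpos.ne']
  · rw [← Matrix.trace_sum, ← Finset.mul_sum, hΓ.sum_orientedObservable, Matrix.trace_mul_comm,
      mul_smul_comm, Matrix.mul_vecMulVec, hHx, Matrix.smul_vecMulVec, Matrix.trace_smul,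
      Matrix.trace_smul, Matrix.trace_vecMulVec, smul_eq_mul, smul_eq_mul]
    field_simp

omit [DecidableEq V] in
/-- Averages over the automorphism group are constant on the edges of an edge-transitive graph. -/
theorem IsEdgeTransitive.card_mul_sum_aut (hG : IsEdgeTransitive G) [Fintype (G ≃g G)]
    (c : G.edgeSet → ℝ) (e : G.edgeSet) :
    (G.edgeFinset.card : ℝ) * ∑ f : G ≃g G, c (f.lineGraph e)
      = Fintype.card (G ≃g G) * ∑ e, c e := by
  have hconst : ∀ e', ∑ f : G ≃g G, c (f.lineGraph e') = ∑ f : G ≃g G, c (f.lineGraph e) := by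
    intro e'
    obtain ⟨g, hg⟩ := hG e e.2 e' e'.2
    refine Fintype.sum_equiv (Equiv.mulRight g) _ _ fun f => ?_
    congr 1
    apply Subtype.ext
    change Sym2.map f (e' : Sym2 V) = Sym2.map (f * g) (e : Sym2 V)
    rw [← hg, Sym2.map_map]
    rfl
  calc (G.edgeFinset.card : ℝ) * ∑ f : G ≃g G, c (f.lineGraph e)
      = ∑ e', ∑ f : G ≃g G, c (f.lineGraph e') := by
        rw [Finset.sum_congr rfl fun e' _ => hconst e', Finset.sum_const, Finset.card_univ,
          ← SimpleGraph.edgeFinset_card, nsmul_eq_mul]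
    _ = ∑ f : G ≃g G, ∑ e', c e' := by
        rw [Finset.sum_comm]
        exact Finset.sum_congr rfl fun f _ => Equiv.sum_comp f.lineGraph.toEquiv c
    _ = _ := by rw [Finset.sum_const, Finset.card_univ, nsmul_eq_mul]

theorem HasAntiCommGraph.comp_iso {W W' : Type*} {H : SimpleGraph W} {H' : SimpleGraph W'}
    {A : W' → Matrix (Fin d) (Fin d) ℂ} (hA : HasAntiCommGraph H' A) (f : H ≃g H') :
    HasAntiCommGraph H fun w => A (f w) :=
  ⟨fun _ => hA.isHermitian _, fun _ => hA.mul_self _,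
    fun v w => (f.map_adj_iff (v := v) (w := w)).symm.trans (hA.adj_iff _ _),
    fun _ _ h => hA.commute _ _ fun h' => h (f.map_adj_iff.mp h')⟩

/-- A state of maximal total correlation yields a joint measurement with visibilities equal to its
correlations `c e`; averaging over the automorphisms makes them all equal. -/
theorem IsEdgeTransitive.mem_compatibleVisibilities (hG : IsEdgeTransitive G)
    (hE : G.edgeSet.Nonempty) (hd : 0 < d) (hΓ : IsMajoranaFamily Γ)
    {σ : GraphOrientation G} (hσ : skewEnergy G σ = maxSkewEnergy G) :
    maxSkewEnergy G / (2 * (G.edgeFinset.card : ℝ)) ∈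
      compatibleVisibilities (orientedObservable σ Γ) := by
  classical
  have : Finite (G ≃g G) := DFunLike.finite _
  have := Fintype.ofFinite (G ≃g G)
  have hquad := hΓ.isQuadraticFamily_orientedObservable σ
  have hA := hquad.hasAntiCommGraph hΓ hd
  obtain ⟨ρ, hρ, hρ1, hρE⟩ := hΓ.exists_state hd hσ
  choose c hc1 hc using fun e =>
    exists_trace_mul_involution_eq (hA.isHermitian e) (hA.mul_self e) hρ hρ1
  have hcsum : ∑ e, c e = 1 / 2 * maxSkewEnergy G := by
    simp only [hc] at hρE
    exact_mod_cast hρE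
  have hcard : 0 < (G.edgeFinset.card : ℝ) := by
    exact_mod_cast Finset.card_pos.mpr (SimpleGraph.edgeFinset_nonempty.mpr
      (SimpleGraph.edgeSet_nonempty.mp hE))
  have haut : 0 < (Fintype.card (G ≃g G) : ℝ) := by
    exact_mod_cast Fintype.card_pos_iff.mpr ⟨1⟩
  have hmean : ∀ e, (Fintype.card (G ≃g G) : ℝ)⁻¹ * ∑ f : G ≃g G, c (f.lineGraph e)
      = maxSkewEnergy G / (2 * (G.edgeFinset.card : ℝ)) := by
    intro e
    have := hG.card_mul_sum_aut c e
    rw [hcsum] at this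
    field_simp
    linarith
  -- for every automorphism `f`, a joint measurement with visibility `c (f e)` at the edge `e`
  choose K hK hKA using fun f : G ≃g G =>
    exists_povm_of_hasAntiCommGraph hA (hA.comp_iso f.lineGraph) (Ω := Unit) (F := fun _ => ρ)
      (fun _ => hρ) (by simpa using hρ1)
  refine ⟨⟨?_, ?_⟩, ?_⟩
  · rw [← hσ, skewEnergy_eq_sum_abs_eigenvalues]
    positivity
  · have : ∑ e, c e ≤ G.edgeFinset.card := by
      calc ∑ e, c e ≤ ∑ e : G.edgeSet, (1 : ℝ) :=
            Finset.sum_le_sum fun e _ => (abs_le.mp (hc1 e)).2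
        _ = G.edgeFinset.card := by
            rw [Finset.sum_const, Finset.card_univ, ← SimpleGraph.edgeFinset_card, nsmul_eq_mul,
              mul_one]
    rw [div_le_one (by positivity)]
    linarith
  · refine jointlyMeasurable_of_postProcessing
      (Ω := (G ≃g G) × ((G.edgeSet → ℤˣ) × Unit))
      (K := fun q => ((Fintype.card (G ≃g G) : ℝ)⁻¹ : ℂ) • K q.1 q.2)
      ⟨fun q => ((hK q.1).posSemidef q.2).smul ?_, ?_⟩ (fun e q => ((q.2.1 e : ℤ) : ℝ)) ?_ ?_
    · rw [← Complex.ofReal_inv]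
      exact_mod_cast inv_nonneg.mpr haut.le
    · rw [← Finset.smul_sum, Fintype.sum_prod_type]
      simp only [(hK _).sum_eq_one]
      rw [Finset.sum_const, Finset.card_univ, ← Nat.cast_smul_eq_nsmul ℂ, smul_smul]
      have : (Fintype.card (G ≃g G) : ℂ) ≠ 0 := by exact_mod_cast haut.ne'
      push_cast
      rw [inv_mul_cancel₀ this, one_smul]
    · intro e q
      rcases Int.units_eq_one_or (q.2.1 e) with h | h <;> simp [h]
    · intro e
      rw [noisyObservable_of_trace_eq_zero _ (hquad.trace_eq_zero hΓ e), Fintype.sum_prod_type]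
      have hf : ∀ f : G ≃g G, ∑ p : (G.edgeSet → ℤˣ) × Unit, (((p.1 e : ℤ) : ℝ) : ℂ) •
          ((Fintype.card (G ≃g G) : ℝ)⁻¹ : ℂ) • K f p
          = (((Fintype.card (G ≃g G) : ℝ)⁻¹ * c (f.lineGraph e) : ℝ) : ℂ) •
            orientedObservable σ Γ e := by
        intro f
        have h1 := hKA f e fun _ => 1
        simp only [mul_one, one_smul, Finset.univ_unique, Finset.sum_singleton] at h1
        rw [Matrix.trace_mul_comm, hc] at h1
        simp only [smul_comm _ ((Fintype.card (G ≃g G) : ℝ)⁻¹ : ℂ), ← Finset.smul_sum]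
        rw [Complex.ofReal_mul, Complex.ofReal_inv, mul_smul, ← h1]
        congr 1
      rw [Finset.sum_congr rfl fun f _ => hf f, ← Finset.sum_smul, ← Complex.ofReal_sum,
        ← Finset.mul_sum, hmean]

end Robustness

theorem theorem2 {V : Type*} [Fintype V] [DecidableEq V] (G : SimpleGraph V)
    [DecidableRel G.Adj] (hE : G.edgeSet.Nonempty) :
    -- `L(G)` is realised by quadratic Majorana observables, which exist
    (∃ d : ℕ, 0 < d ∧ ∃ (Γ : V → Matrix (Fin d) (Fin d) ℂ)
      (A : G.edgeSet → Matrix (Fin d) (Fin d) ℂ), IsMajoranaFamily Γ ∧ IsQuadraticFamily G Γ A) ∧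
    (∀ d : ℕ, 0 < d → ∀ (Γ : V → Matrix (Fin d) (Fin d) ℂ)
      (A : G.edgeSet → Matrix (Fin d) (Fin d) ℂ), IsMajoranaFamily Γ → IsQuadraticFamily G Γ A →
        HasAntiCommGraph G.lineGraph A) ∧
    -- `η(L(G))` is the robustness, attained as a maximum, of every realisation of `L(G)`
    (∀ d : ℕ, 0 < d → ∀ A : G.edgeSet → Matrix (Fin d) (Fin d) ℂ, HasAntiCommGraph G.lineGraph A →
      IsGreatest (compatibleVisibilities A) (incompatibilityRobustness G.lineGraph)) ∧
    -- the skew-energy bound, with equality for edge-transitive graphs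
    incompatibilityRobustness G.lineGraph ≤ maxSkewEnergy G / (2 * (G.edgeFinset.card : ℝ)) ∧
    (IsEdgeTransitive G →
      incompatibilityRobustness G.lineGraph = maxSkewEnergy G / (2 * (G.edgeFinset.card : ℝ))) := by
  obtain ⟨d, hd, Γ, hΓ⟩ := exists_isMajoranaFamily V
  obtain ⟨σ, hσ⟩ := exists_skewEnergy_eq_max G
  have hquad := hΓ.isQuadraticFamily_orientedObservable σ
  have hgr := (hquad.hasAntiCommGraph hΓ hd).isGreatest_incompatibilityRobustness hd
  have hle := le_maxSkewEnergy_of_mem_compatibleVisibilities hE hd hΓ σ hgr.1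
  exact ⟨⟨d, hd, Γ, orientedObservable σ Γ, hΓ, hquad⟩,
    fun d hd Γ A hΓ hA => hA.hasAntiCommGraph hΓ hd,
    fun d hd A hA => hA.isGreatest_incompatibilityRobustness hd, hle,
    fun hG => le_antisymm hle (hgr.2 (hG.mem_compatibleVisibilities hE hd hΓ hσ))⟩
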